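/- **Theorem.** Let $D\subset\mathbb R^d$, $d\ge1$, be a bounded open set (for example a bounded regular domain), let $H=L^2(D;\mathbb R^2)=L^2(D)\times L^2(D)$ with norm $|\cdot|_H$, and let $\hat A$ be the realization of the Laplace operator in $L^2(D)$ with Dirichlet boundary conditions (that is, $\hat A u=f$ iff $u\in H^1_0(D)$ and $\Delta u=f\in L^2(D)$ weakly). Let $\{\hat e_k\}_{k\ge1}$ be an orthonormal basis of $L^2(D)$ with $\hat A\hat e_k=-\hat\alpha_k\hat e_k$ and $0<\hat\alpha_1\le\hat\alpha_2\le\cdots$, and put $e_{2k-1}=(\hat e_k,0)$, $e_{2k}=(0,\hat e_k)$, $\alpha_{2k-1}=\alpha_{2k}=\hat\alpha_k$. Let $A(x,y)=(\hat Ax,\hat Ay)$ on $D(\hat A)\times D(\hat A)$, let $H^\delta$, $\delta\in\mathbb R$, be the completion of $C_c^\infty(D;\mathbb R^2)$ in the norm $|u|_{H^\delta}^2=\sum_k\alpha_k^\delta\langle u,e_k\rangle_H^2$, and denote also by $A$ the extension $H^1\to H^{-1}$ with $Ae_k=-\alpha_ke_k$. For $\epsilon>0$ and $\mu>0$ let $$J_\epsilon=\begin{pmatrix}\epsilon&1\\-1&\epsilon\end{pmatrix},\qquad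 A^\epsilon_\mu(u,v)=\frac1\mu\,(\mu v,\;Au-J_\epsilon v)\ \text{ on } D(A^\epsilon_\mu)=H^1\times H\subset\mathcal H:=H\times H^{-1},\qquad A_\epsilon=J_\epsilon^{-1}A\ \text{ in } H .$$ Then $A^\epsilon_\mu$ and $A_\epsilon$ generate strongly continuous semigroups $S^\epsilon_\mu(t)$ on $\mathcal H$ and $T_\epsilon(t)$ on $H$, $t\ge0$. Write $\Pi_1(x,y)=x$ for $(x,y)\in\mathcal H$, and for $n\in\mathbb N$ let $P_n$ be the orthogonal projection of $H$ onto $\mathrm{span}\{e_1,\dots,e_{2n}\}$. For every $\epsilon>0$, $0<t_0<T$ and $n\in\mathbb N$, $$\lim_{\mu\downarrow0}\ \sup_{0\le t\le T}\ \sup_{|x|_H\le1}\left|\Pi_1S^\epsilon_\mu(t)(P_nx,0)-T_\epsilon(t)P_nx\right|_H=0$$ and $$\lim_{\mu\downarrow0}\ \sup_{t_0\le t\le T}\ \sup_{|y|_H\le1}\left|\frac1\mu\,\Pi_1S^\epsilon_\mu(t)(0,P_ny)-T_\epsilon(t)J_\epsilon^{-1}P_ny\right|_H=0 .$$ -/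

import Mathlib

open MeasureTheory Filter Topology
open scoped NNReal ENNReal ContDiff

namespace MagneticSK

noncomputable section

/-! ### Strongly continuous semigroups and their generators -/

section Semigroups

variable {X : Type*} [NormedAddCommGroup X] [NormedSpace ℝ X]

/-- A strongly continuous semigroup of bounded linear operators on `X`. -/
structure IsC0Semigroup (S : ℝ≥0 → X →L[ℝ] X) : Prop where
  map_zero : S 0 = ContinuousLinearMap.id ℝ X
  map_add : ∀ s t : ℝ≥0, S (s + t) = (S s).comp (S t)
  continuous_apply : ∀ x : X, Continuous fun t : ℝ≥0 => S t x

/-- The (graph of the) infinitesimal generator of a family `S`: the pairs `(x, y)` such that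
`(S h x - x) / h → y` as `h ↓ 0`. -/
def generator (S : ℝ≥0 → X →L[ℝ] X) : Set (X × X) :=
  {p | Tendsto (fun h : ℝ≥0 => (h : ℝ)⁻¹ • (S h p.1 - p.1)) (𝓝[>] 0) (𝓝 p.2)}

/-- The unbounded operator with graph `G` generates the strongly continuous semigroup `S`:
the generator of `S` is exactly `G`, domains included. -/
def Generates (G : Set (X × X)) (S : ℝ≥0 → X →L[ℝ] X) : Prop :=
  IsC0Semigroup S ∧ generator S = G

open Classical in
/-- The strongly continuous semigroup generated by the unbounded operator with graph `G`
(the zero family if there is none). A semigroup is determined by its generator, so that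
the choice is immaterial. -/
def semigroupOf (G : Set (X × X)) : ℝ≥0 → X →L[ℝ] X :=
  if h : ∃ S : ℝ≥0 → X →L[ℝ] X, Generates G S then h.choose else 0

end Semigroups

/-! ### The matrices `J_ε` -/

/-- `J_ε = J_0 + ε I`. -/
def Jmat (ε : ℝ) : Matrix (Fin 2) (Fin 2) ℝ := !![ε, 1; -1, ε]

/-- The action of a `2 × 2` real matrix on pairs `(x, y)` of elements of a normed space `F`:
`(M x)_i = ∑ j, M i j • x_j`. -/
def matAct {F : Type*} [NormedAddCommGroup F] [NormedSpace ℝ F]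
    (M : Matrix (Fin 2) (Fin 2) ℝ) (x : PiLp 2 fun _ : Fin 2 => F) : PiLp 2 fun _ : Fin 2 => F :=
  WithLp.toLp 2 fun i => ∑ j, M i j • x j

/-! ### Function spaces on the domain and the Dirichlet Laplacian -/

section Domain

variable {d : ℕ} (D : TopologicalSpace.Opens (EuclideanSpace ℝ (Fin d)))

/-- Lebesgue measure on `D`. -/
abbrev vol : Measure (EuclideanSpace ℝ (Fin d)) :=
  volume.restrict (D : Set (EuclideanSpace ℝ (Fin d)))

/-- `L²(D)`. -/
abbrev L2 : Type := Lp ℝ 2 (vol D)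

/-- `L²(D; ℝ^d)`, in which gradients live. -/
abbrev L2Grad : Type := Lp (EuclideanSpace ℝ (Fin d)) 2 (vol D)

/-- `H = L²(D; ℝ²)`, as pairs of elements of `L²(D)` with
`⟪(x₁, y₁), (x₂, y₂)⟫ = ∫ x₁ x₂ + ∫ y₁ y₂`. -/
abbrev HSpace : Type := PiLp 2 fun _ : Fin 2 => L2 D

/-- `φ ∈ C_c^∞(D)`. -/
structure IsTest (φ : EuclideanSpace ℝ (Fin d) → ℝ) : Prop where
  smooth : ContDiff ℝ ∞ φ
  compact : HasCompactSupport φ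
  support : tsupport φ ⊆ (D : Set (EuclideanSpace ℝ (Fin d)))

/-- `u ∈ C_c^∞(D; ℝ²)`, as an element of `L²(D; ℝ²)`. -/
def IsTestField (u : HSpace D) : Prop :=
  ∀ i, ∃ φ : EuclideanSpace ℝ (Fin d) → ℝ, IsTest D φ ∧ u i =ᵐ[vol D] φ

/-- The graph of the gradient on `H¹₀(D)`: the closure in `L²(D) × L²(D; ℝ^d)` of the pairs
`(φ, ∇φ)` with `φ ∈ C_c^∞(D)`. Thus `(u, g)` belongs to it iff `u ∈ H¹₀(D)` and `g = ∇u`. -/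
def gradH10 : Set (L2 D × L2Grad D) :=
  closure {p | ∃ φ : EuclideanSpace ℝ (Fin d) → ℝ,
    IsTest D φ ∧ p.1 =ᵐ[vol D] φ ∧ p.2 =ᵐ[vol D] gradient φ}

/-- The realization `Â` of the Laplace operator in `L²(D)` with Dirichlet boundary conditions:
`u ∈ D(Â)` and `Â u = f` iff `u ∈ H¹₀(D)` and `Δ u = f ∈ L²(D)` weakly, that is
`∫ ∇u · ∇φ = - ∫ f φ` for all `φ ∈ C_c^∞(D)`. -/
def IsDirichletLaplacian (u f : L2 D) : Prop :=
  ∃ g : L2Grad D, (u, g) ∈ gradH10 D ∧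
    ∀ φ : EuclideanSpace ℝ (Fin d) → ℝ, IsTest D φ →
      ∫ x, inner ℝ (g x) (gradient φ x) ∂(vol D) = - ∫ x, f x * φ x ∂(vol D)

/-- The graph of `A_ε = J_ε⁻¹ A` in `H`, where `A (x, y) = (Â x, Â y)` on `D(Â) × D(Â)`. -/
def firstOrderOp (ε : ℝ) : Set (HSpace D × HSpace D) :=
  {p | ∃ f : HSpace D, (∀ i, IsDirichletLaplacian D (p.1 i) (f i)) ∧
    p.2 = matAct (Jmat ε)⁻¹ f}

/-- `T_ε(t)`, the strongly continuous semigroup in `H` generated by `A_ε`. -/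
def firstOrderSemigroup (ε : ℝ) : ℝ≥0 → HSpace D →L[ℝ] HSpace D :=
  semigroupOf (firstOrderOp D ε)

/-- An orthonormal basis `ê_k` of `L²(D)` of eigenfunctions of the Dirichlet Laplacian,
`Â ê_k = - α̂_k ê_k` with `0 < α̂_0 ≤ α̂_1 ≤ …`. (Indices start from `0`.) -/
structure DirichletEigenbasis where
  basis : HilbertBasis ℕ ℝ (L2 D)
  eig : ℕ → ℝ
  eig_pos : ∀ k, 0 < eig k
  eig_mono : Monotone eig
  eigen : ∀ k, IsDirichletLaplacian D (basis k) (-(eig k) • basis k)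

variable {D}

lemma IsTest.memLp {φ : EuclideanSpace ℝ (Fin d) → ℝ} (h : IsTest D φ) :
    MemLp φ 2 (vol D) :=
  (h.smooth.continuous.memLp_of_hasCompactSupport h.compact)

/-- Test fields are dense in `H`. -/
lemma closure_isTestField : closure {u : HSpace D | IsTestField D u} = Set.univ := by
  have key : Dense {v : L2 D | ∃ φ : EuclideanSpace ℝ (Fin d) → ℝ,
      IsTest D φ ∧ v =ᵐ[vol D] φ} := by
    let V : Submodule ℝ (L2 D) :=
      { carrier := {v : L2 D | ∃ φ : EuclideanSpace ℝ (Fin d) → ℝ,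
          IsTest D φ ∧ v =ᵐ[vol D] φ}
        add_mem' := by
          rintro a b ⟨φ, hφ, ha⟩ ⟨ψ, hψ, hb⟩
          exact ⟨φ + ψ, ⟨hφ.smooth.add hψ.smooth, hφ.compact.add hψ.compact,
            (tsupport_add φ ψ).trans (Set.union_subset hφ.support hψ.support)⟩,
            (Lp.coeFn_add a b).trans (ha.add hb)⟩
        zero_mem' := ⟨0, ⟨contDiff_const, HasCompactSupport.zero, by simp [tsupport]⟩,
          Lp.coeFn_zero _ _ _⟩
        smul_mem' := by
          rintro c a ⟨φ, hφ, ha⟩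
          exact ⟨c • φ, ⟨contDiff_const.smul hφ.smooth, hφ.compact.smul_left,
            (closure_mono (Function.support_const_smul_subset c φ)).trans hφ.support⟩,
            (Lp.coeFn_smul c a).trans (ha.const_smul c)⟩ }
    have hV : V.topologicalClosure = ⊤ := by
      rw [Submodule.topologicalClosure_eq_top_iff, Submodule.eq_bot_iff]
      intro f hf
      have hloc : LocallyIntegrableOn f (D : Set (EuclideanSpace ℝ (Fin d))) volume :=
        locallyIntegrableOn_of_locallyIntegrable_restrict
          ((Lp.memLp f).locallyIntegrable (by norm_num))
      have h0 := D.isOpen.ae_eq_zero_of_integral_contDiff_smul_eq_zero hloc (by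
        intro g hg hgc hgs
        have hgt : IsTest D g := ⟨hg, hgc, hgs⟩
        have h1 := hf (hgt.memLp.toLp g) ⟨g, hgt, MemLp.coeFn_toLp _⟩
        rw [L2.inner_def] at h1
        rw [← setIntegral_eq_integral_of_forall_compl_eq_zero
          (s := (D : Set (EuclideanSpace ℝ (Fin d))))
          (fun x hx => by
            rw [image_eq_zero_of_notMem_tsupport (fun h => hx (hgs h)), zero_smul]), ← h1]
        apply integral_congr_ae
        filter_upwards [hgt.memLp.coeFn_toLp] with x hx
        simp [hx, mul_comm])
      rw [Lp.eq_zero_iff_ae_eq_zero]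
      exact (ae_restrict_iff' D.isOpen.measurableSet).2 h0
    have := Submodule.dense_iff_topologicalClosure_eq_top.2 hV
    exact this
  have := dense_pi Set.univ (fun (i : Fin 2) _ => key)
  rw [← dense_iff_closure_eq]
  have h2 := (PiLp.homeomorph 2 fun _ : Fin 2 => L2 D).symm.surjective.denseRange
  have h3 := this.preimage (PiLp.homeomorph 2 fun _ : Fin 2 => L2 D).isOpenMap
  refine h3.mono ?_
  intro u hu i
  exact hu i (Set.mem_univ i)

namespace DirichletEigenbasis

variable (E : DirichletEigenbasis D)

/-- The coefficients of `u ∈ H` along `(ê_k, 0)` and `(0, ê_k)`. -/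
def coef (u : HSpace D) (k : ℕ) : EuclideanSpace ℝ (Fin 2) :=
  WithLp.toLp 2 fun i => inner ℝ (E.basis k) (u i)

/-- The orthonormal basis `(ê_0, 0), (0, ê_0), (ê_1, 0), (0, ê_1), …` of `H`. -/
def e (k : ℕ) : HSpace D :=
  PiLp.single 2 (⟨k % 2, Nat.mod_lt k two_pos⟩ : Fin 2) (E.basis (k / 2))

/-- `P_n`, the orthogonal projection of `H` onto the span of the first `2n` elements of the
basis `e`. -/
def P (n : ℕ) : HSpace D →L[ℝ] HSpace D :=
  haveI : FiniteDimensional ℝ (Submodule.span ℝ (Set.range fun k : Fin (2 * n) => E.e k)) :=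
    FiniteDimensional.span_of_finite ℝ (Set.finite_range _)
  haveI : CompleteSpace (Submodule.span ℝ (Set.range fun k : Fin (2 * n) => E.e k)) :=
    FiniteDimensional.complete ℝ _
  (Submodule.span ℝ (Set.range fun k : Fin (2 * n) => E.e k)).starProjection

/-- Weighted coefficient sequences: the distribution `u` with coefficients `c_k ∈ ℝ²` is
represented by the sequence `α_k^(δ/2) c_k`, so that the `ℓ²` norm of the representative is
`(∑ α_k^δ |c_k|²)^(1/2)`. -/
abbrev Seq2 : Type := lp (fun _ : ℕ => EuclideanSpace ℝ (Fin 2)) 2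

/-- `H^δ`, the completion of `C_c^∞(D; ℝ²)` with respect to the norm
`|u|² = ∑ α_k^δ ⟪u, e_k⟫²`, realized as the closure in `ℓ²` of the image of `C_c^∞(D; ℝ²)`
under the isometric embedding `u ↦ (α_k^(δ/2) ⟪u, e_k⟫)_k`. -/
def Hs (δ : ℝ) : Submodule ℝ Seq2 :=
  (Submodule.span ℝ {a : Seq2 | ∃ u : HSpace D, IsTestField D u ∧
    ∀ k, a k = E.eig k ^ (δ / 2) • E.coef u k}).topologicalClosure

/-- The coefficients `c_k ∈ ℝ²` of an element of `H^δ`. -/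
def hsCoef {δ : ℝ} (a : E.Hs δ) (k : ℕ) : EuclideanSpace ℝ (Fin 2) :=
  E.eig k ^ (-(δ / 2)) • (a : Seq2) k

lemma norm_coef_sq (u : HSpace D) (k : ℕ) :
    ‖E.coef u k‖ ^ 2 = ∑ i, (E.basis.repr (u i) k) ^ 2 := by
  simp [EuclideanSpace.norm_sq_eq, coef, HilbertBasis.repr_apply_apply]

lemma hasSum_norm_coef_sq (u : HSpace D) :
    HasSum (fun k => ‖E.coef u k‖ ^ 2) (‖u‖ ^ 2) := by
  simp_rw [norm_coef_sq, PiLp.norm_sq_eq_of_L2]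
  refine hasSum_sum fun i _ => ?_
  have h := lp.hasSum_norm (p := 2) (by norm_num) (E.basis.repr (u i))
  simpa using h

lemma norm_weighted_le (u : HSpace D) (k : ℕ) :
    ‖E.eig k ^ (-(1 : ℝ) / 2) • E.coef u k‖ ^ 2 ≤ (E.eig 0)⁻¹ * ‖E.coef u k‖ ^ 2 := by
  have hk := E.eig_pos k
  have h0 := E.eig_pos 0
  rw [norm_smul, mul_pow, Real.norm_of_nonneg (Real.rpow_nonneg hk.le _),
    ← Real.rpow_natCast, ← Real.rpow_mul hk.le]
  have : (-(1 : ℝ) / 2 * (2 : ℕ)) = -1 := by norm_num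
  rw [this, Real.rpow_neg_one]
  gcongr
  exact E.eig_mono (Nat.zero_le k)

lemma summable_weighted (u : HSpace D) :
    Summable fun k => ‖E.eig k ^ (-(1 : ℝ) / 2) • E.coef u k‖ ^ 2 :=
  Summable.of_nonneg_of_le (fun _ => by positivity) (E.norm_weighted_le u)
    ((E.hasSum_norm_coef_sq u).summable.mul_left _)

/-- The map `u ↦ (α_k^(-1/2) ⟪u, e_k⟫)_k` from `H` to `ℓ²`. -/
def toSeq : HSpace D →L[ℝ] Seq2 :=
  LinearMap.mkContinuous
    { toFun := fun u => ⟨fun k => E.eig k ^ (-(1 : ℝ) / 2) • E.coef u k,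
        memℓp_gen (by simpa using E.summable_weighted u)⟩
      map_add' := by
        intro u v
        ext k i
        change E.eig k ^ (-(1 : ℝ) / 2) * inner ℝ (E.basis k) ((u + v) i) =
          E.eig k ^ (-(1 : ℝ) / 2) * inner ℝ (E.basis k) (u i) +
            E.eig k ^ (-(1 : ℝ) / 2) * inner ℝ (E.basis k) (v i)
        simp [coef, inner_add_right, mul_add]
      map_smul' := by
        intro c u
        ext k i
        simp [coef, inner_smul_right, mul_left_comm] }
    (Real.sqrt (E.eig 0)⁻¹) (by
      intro u
      have h0 := E.eig_pos 0
      refine (sq_le_sq₀ (norm_nonneg _) (by positivity)).1 ?_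
      rw [mul_pow, Real.sq_sqrt (by positivity)]
      have h := lp.hasSum_norm (p := 2) (by norm_num) (⟨fun k =>
        E.eig k ^ (-(1 : ℝ) / 2) • E.coef u k,
        memℓp_gen (by simpa using E.summable_weighted u)⟩ : Seq2)
      refine hasSum_le (fun k => ?_) (by simpa using h)
        ((E.hasSum_norm_coef_sq u).mul_left (E.eig 0)⁻¹)
      exact E.norm_weighted_le u k)

lemma toSeq_apply (u : HSpace D) (k : ℕ) :
    E.toSeq u k = E.eig k ^ (-(1 : ℝ) / 2) • E.coef u k := rfl

lemma toSeq_mem (u : HSpace D) : E.toSeq u ∈ E.Hs (-1) := by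
  have hu : u ∈ closure {u : HSpace D | IsTestField D u} := by
    rw [closure_isTestField]; trivial
  refine map_mem_closure E.toSeq.continuous hu ?_
  intro v hv
  exact Submodule.subset_span ⟨v, hv, fun k => E.toSeq_apply v k⟩

/-- The embedding of `H` into `H^{-1}`, which preserves coefficients (see `hsCoef_emb`). -/
def emb (u : HSpace D) : E.Hs (-1) := ⟨E.toSeq u, E.toSeq_mem u⟩

lemma hsCoef_emb (u : HSpace D) (k : ℕ) : E.hsCoef (E.emb u) k = E.coef u k := by
  have hk := E.eig_pos k
  simp only [hsCoef, emb, toSeq_apply, smul_smul]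
  rw [← Real.rpow_add hk]
  norm_num

/-- The phase space `𝓗 = H × H^{-1}`. -/
abbrev Phase : Type := WithLp 2 (HSpace D × E.Hs (-1))

/-- The graph of the operator `A_μ^ε (u, v) = (1/μ) (μ v, A u - J_ε v)` in `𝓗 = H × H^{-1}` with
domain `H¹ × H`. The first two conditions say that `u ∈ H¹` and that `v ∈ H`, the third and the
fourth one give the two components of the image; here `A : H¹ → H^{-1}` multiplies the
coefficients along `(ê_k, 0)` and `(0, ê_k)` by `-α_k`. -/
def secondOrderOp (ε μ : ℝ) : Set (E.Phase × E.Phase) :=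
  {p | (∃ a : E.Hs 1, ∀ k, E.hsCoef a k = E.coef p.1.fst k) ∧
    ∃ v : HSpace D, p.1.snd = E.emb v ∧ p.2.fst = v ∧
      ∀ k, E.hsCoef p.2.snd k =
        μ⁻¹ • (-(E.eig k) • E.coef p.1.fst k - matAct (Jmat ε) (E.coef v k))}

/-- `S_μ^ε(t)`, the strongly continuous semigroup in `𝓗` generated by `A_μ^ε`. -/
def secondOrderSemigroup (ε μ : ℝ) : ℝ≥0 → E.Phase →L[ℝ] E.Phase :=
  semigroupOf (E.secondOrderOp ε μ)

end DirichletEigenbasis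

end Domain

end

end MagneticSK

/-! Both operators are block diagonal in the eigenbasis: the first-order one acts on each
coefficient in `ℝ²` by `-α_k J⁻¹`, the second-order one on each pair (position, rescaled velocity)
in `ℝ² × ℝ²`. Their semigroups are therefore the block diagonal exponentials, and because `P_n`
leaves only `n` blocks, the theorem reduces to a small mass limit for one damped oscillator with
fixed `α`.

Generation: uniformly bounded block exponentials on `ℓ²` form a strongly continuous semigroup whose
generator is the maximal diagonal operator (`generator_expDiag`). The domains in the statement are
maximal ones: this is `isDirichletLaplacian_iff` for the Laplacian, and in `secondOrderOp_eq` it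
rests on the fact that `H^1` and `H^{-1}`, defined by closures, fill all of `ℓ²` (`Hs_one`,
`Hs_neg_one`). The semigroups are obtained by choice, so their blocks are identified through
uniqueness for ODEs (`Generates.coord_apply`).

The oscillator: let `w = μ u'`, so `u' = w/μ`, `w' = -J w/μ - α u`, and let `K = J⁻¹`, `z' = -α K
z`. In `q = u + K w` the singular terms cancel and `q' = -α K u = -α K (q - K w)`, which is the
limit equation with error `α K K w`. Gronwall gives `u - z = O(sup |w|)`. With zero initial velocity
the energy `α|u|² + |w|²/μ` forces `|w| ≤ √(μα)`, which settles the first limit. With initial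
velocity `y/μ` the momentum starts at size one and decays like `exp(-εt/(2μ))` up to `O(μ)`
(`velocity_sq_le`). Adding a second corrector `αμ K³ w` makes the forcing `O(μ)` uniformly in time;
the remaining term `K w(t)` is an initial layer, since `u(0) = 0` whereas `z(0) = K w(0)`, and this
is why the second limit needs `t ≥ t₀ > 0`. -/

namespace MagneticSK

noncomputable section

/-! ### Block diagonal semigroups -/

section BlockDiagonal

variable {V : Type*} [NormedAddCommGroup V] [NormedSpace ℝ V]

/-- The operator on `ℓ²(V)` acting by `B k` on the `k`-th coordinate. -/
def lpDiag (B : ℕ → V →L[ℝ] V) (C : ℝ) (hB : ∀ k, ‖B k‖ ≤ C) :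
    lp (fun _ : ℕ => V) 2 →L[ℝ] lp (fun _ : ℕ => V) 2 :=
  have hC : 0 ≤ C := (norm_nonneg _).trans (hB 0)
  have hle : ∀ (f : lp (fun _ : ℕ => V) 2) k, ‖B k (f k)‖ ^ 2 ≤ C ^ 2 * ‖f k‖ ^ 2 := fun f k => by
    rw [← mul_pow]
    gcongr
    exact (B k).le_of_opNorm_le (hB k) _
  have hsum : ∀ f : lp (fun _ : ℕ => V) 2, HasSum (fun k => ‖f k‖ ^ 2) (‖f‖ ^ 2) := fun f => by
    simpa using lp.hasSum_norm (p := 2) (by norm_num) f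
  have hmem : ∀ f : lp (fun _ : ℕ => V) 2, Memℓp (fun k => B k (f k)) 2 := fun f =>
    memℓp_gen (by
      simpa using Summable.of_nonneg_of_le (fun _ => by positivity) (hle f)
        ((hsum f).summable.mul_left _))
  LinearMap.mkContinuous
    { toFun := fun f => ⟨fun k => B k (f k), hmem f⟩
      map_add' := fun f g => by ext k; exact map_add (B k) _ _
      map_smul' := fun c f => by ext k; exact map_smul (B k) _ _ }
    C (fun f => by
      refine (sq_le_sq₀ (norm_nonneg _) (by positivity)).1 ?_
      rw [mul_pow]
      exact hasSum_le (hle f) (hsum ⟨fun k => B k (f k), hmem f⟩) ((hsum f).mul_left _))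

lemma lpDiag_apply (B : ℕ → V →L[ℝ] V) (C : ℝ) (hB : ∀ k, ‖B k‖ ≤ C)
    (f : lp (fun _ : ℕ => V) 2) (k : ℕ) : lpDiag B C hB f k = B k (f k) := rfl

lemma norm_lpDiag_le (B : ℕ → V →L[ℝ] V) (C : ℝ) (hB : ∀ k, ‖B k‖ ≤ C) :
    ‖lpDiag B C hB‖ ≤ C :=
  by
  unfold lpDiag
  exact LinearMap.mkContinuous_norm_le _ ((norm_nonneg _).trans (hB 0)) _

lemma hasDerivAt_exp_apply [CompleteSpace V] (A : V →L[ℝ] V) (v : V) (t : ℝ) :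
    HasDerivAt (fun s : ℝ => NormedSpace.exp (s • A) v) (A (NormedSpace.exp (t • A) v)) t :=
  (hasDerivAt_exp_smul_const' (𝕂 := ℝ) A t).clm_apply (hasDerivAt_const t v) |>.congr_deriv (by simp)

lemma hasDerivAt_exp_apply' [CompleteSpace V] (A : V →L[ℝ] V) (v : V) (t : ℝ) :
    HasDerivAt (fun s : ℝ => NormedSpace.exp (s • A) v) (NormedSpace.exp (t • A) (A v)) t :=
  (hasDerivAt_exp_smul_const (𝕂 := ℝ) A t).clm_apply (hasDerivAt_const t v) |>.congr_deriv (by simp)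

lemma exp_zero_smul_apply (A : V →L[ℝ] V) (v : V) : NormedSpace.exp ((0 : ℝ) • A) v = v := by
  rw [zero_smul, NormedSpace.exp_zero, one_apply_eq_self]

variable {X : Type*} [NormedAddCommGroup X] [NormedSpace ℝ X]
  (Φ : X ≃ₗᵢ[ℝ] lp (fun _ : ℕ => V) 2) (M : ℕ → V →L[ℝ] V)

/-- The maximal operator acting by `M k` on the `k`-th coordinate. -/
def diagOp : Set (X × X) := {p | ∀ k, Φ p.2 k = M k (Φ p.1 k)}

/-- Coordinates as continuous linear maps. -/
def coordCLM (k : ℕ) : X →L[ℝ] V :=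
  (lp.evalCLM ℝ (fun _ : ℕ => V) 2 k) ∘L
    (Φ.toContinuousLinearEquiv : X →L[ℝ] lp (fun _ : ℕ => V) 2)

lemma coordCLM_apply (k : ℕ) (x : X) : coordCLM Φ k x = Φ x k := rfl

lemma ext_coord {x y : X} (h : ∀ k, Φ x k = Φ y k) : x = y :=
  Φ.injective (by ext k; exact h k)

/-- The block diagonal family of exponentials. -/
def expDiag {C : ℝ} (hC : ∀ k, ∀ t : ℝ≥0, ‖NormedSpace.exp ((t : ℝ) • M k)‖ ≤ C) (t : ℝ≥0) :
    X →L[ℝ] X :=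
  (Φ.symm.toContinuousLinearEquiv : lp (fun _ : ℕ => V) 2 →L[ℝ] X) ∘L
    (lpDiag (fun k => NormedSpace.exp ((t : ℝ) • M k)) C fun k => hC k t) ∘L
      (Φ.toContinuousLinearEquiv : X →L[ℝ] lp (fun _ : ℕ => V) 2)

variable {M} {C : ℝ} (hC : ∀ k, ∀ t : ℝ≥0, ‖NormedSpace.exp ((t : ℝ) • M k)‖ ≤ C)

lemma coord_expDiag (t : ℝ≥0) (x : X) (k : ℕ) :
    Φ (expDiag Φ M hC t x) k = NormedSpace.exp ((t : ℝ) • M k) (Φ x k) := by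
  simp [expDiag, lpDiag_apply]

lemma norm_expDiag_apply_le (t : ℝ≥0) (x : X) : ‖expDiag Φ M hC t x‖ ≤ C * ‖x‖ := by
  have := (lpDiag (fun k => NormedSpace.exp ((t : ℝ) • M k)) C fun k => hC k t).le_of_opNorm_le
    (norm_lpDiag_le _ _ _) (Φ x)
  simpa [expDiag] using this

variable [CompleteSpace V]

/-- Orbits of finitely supported vectors are continuous because each block exponential is. The bound
`C`, uniform in block and time, makes the orbit of `x` a uniform limit of such orbits. -/
lemma continuous_expDiag_apply (x : X) : Continuous fun t : ℝ≥0 => expDiag Φ M hC t x := by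
  classical
  have hC0 : 0 ≤ C := (norm_nonneg _).trans (hC 0 0)
  have hsingle : ∀ k v, Continuous fun t : ℝ≥0 => expDiag Φ M hC t (Φ.symm (lp.single 2 k v)) := by
    intro k v
    have : (fun t : ℝ≥0 => expDiag Φ M hC t (Φ.symm (lp.single 2 k v))) =
        fun t : ℝ≥0 => Φ.symm (lp.singleContinuousLinearMap ℝ (fun _ : ℕ => V) 2 k
          (NormedSpace.exp ((t : ℝ) • M k) v)) := by
      funext t
      refine ext_coord Φ fun j => ?_
      rw [coord_expDiag]
      rcases eq_or_ne j k with rfl | hj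
      · simp
      · simp [hj]
    rw [this]
    have h1 : Continuous fun t : ℝ => NormedSpace.exp (t • M k) v :=
      continuous_iff_continuousAt.2 fun t => (hasDerivAt_exp_apply (M k) v t).continuousAt
    exact Φ.symm.continuous.comp
      ((ContinuousLinearMap.continuous _).comp (h1.comp NNReal.continuous_coe))
  have hfin : ∀ s : Finset ℕ, Continuous fun t : ℝ≥0 =>
      expDiag Φ M hC t (∑ k ∈ s, Φ.symm (lp.single 2 k (Φ x k))) := by
    intro s
    simp_rw [map_sum]
    exact continuous_finsetSum _ fun k _ => hsingle k _
  have hlim : Tendsto (fun s : Finset ℕ => ∑ k ∈ s, Φ.symm (lp.single 2 k (Φ x k))) atTop (𝓝 x) := by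
    have := (lp.hasSum_single (p := 2) (by norm_num) (Φ x)).mapL
      (Φ.symm.toContinuousLinearEquiv : lp (fun _ : ℕ => V) 2 →L[ℝ] X)
    simpa [HasSum] using this
  have hunif : TendstoUniformly (fun (s : Finset ℕ) (t : ℝ≥0) =>
      expDiag Φ M hC t (∑ k ∈ s, Φ.symm (lp.single 2 k (Φ x k))))
      (fun t => expDiag Φ M hC t x) atTop := by
    rw [Metric.tendstoUniformly_iff]
    intro δ hδ
    have h2 : Tendsto (fun s : Finset ℕ =>
        C * ‖x - ∑ k ∈ s, Φ.symm (lp.single 2 k (Φ x k))‖) atTop (𝓝 0) := by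
      simpa using ((tendsto_const_nhds (x := x)).sub hlim).norm.const_mul C
    filter_upwards [h2.eventually_lt_const hδ] with s hs t
    rw [dist_eq_norm, ← map_sub]
    exact (norm_expDiag_apply_le Φ hC t _).trans_lt hs
  exact hunif.continuous (Frequently.of_forall hfin)

lemma isC0Semigroup_expDiag : IsC0Semigroup (expDiag Φ M hC) where
  map_zero := by
    ext x
    refine ext_coord Φ fun k => ?_
    simp [coord_expDiag]
  map_add s t := by
    ext x
    refine ext_coord Φ fun k => ?_
    simp only [coord_expDiag, ContinuousLinearMap.comp_apply, NNReal.coe_add, add_smul]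
    let : NormedAlgebra ℚ (V →L[ℝ] V) := NormedAlgebra.restrictScalars ℚ ℝ _
    rw [NormedSpace.exp_add_of_commute ((Commute.refl (M k)).smul_left _ |>.smul_right _)]
    rfl
  continuous_apply := continuous_expDiag_apply Φ hC

lemma tendsto_coe_nhdsGT_zero : Tendsto ((↑) : ℝ≥0 → ℝ) (𝓝[>] 0) (𝓝[>] 0) := by
  refine tendsto_nhdsWithin_iff.2 ⟨?_, ?_⟩
  · exact (NNReal.continuous_coe.tendsto' 0 0 rfl).mono_left nhdsWithin_le_nhds
  · filter_upwards [self_mem_nhdsWithin] with h hh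
    exact hh

lemma tendsto_slope_nnreal {f : ℝ → X} {f' : X} (hf : HasDerivAt f f' 0) :
    Tendsto (fun h : ℝ≥0 => (h : ℝ)⁻¹ • (f h - f 0)) (𝓝[>] 0) (𝓝 f') := by
  have := (hasDerivWithinAt_iff_tendsto_slope' (s := Set.Ioi 0) (by simp)).1
    hf.hasDerivWithinAt
  refine (this.comp tendsto_coe_nhdsGT_zero).congr fun h => ?_
  simp [slope_def_module]

variable [CompleteSpace X]

/-- Differentiating coordinatewise gives one inclusion. For the maximal domain, `S(t)x - x = ∫₀ᵗ
S(s)y ds` can be checked one coordinate at a time, and the right side is differentiable at `0` in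
the norm of `X` by continuity of the orbit of `y`. -/
lemma generator_expDiag : generator (expDiag Φ M hC) = diagOp Φ M := by
  ext ⟨x, y⟩
  constructor
  · intro h k
    have h1 := ((coordCLM Φ k).continuous.tendsto _).comp h
    have h2 := tendsto_slope_nnreal (hasDerivAt_exp_apply (M k) (Φ x k) 0)
    simp only [exp_zero_smul_apply] at h2
    refine tendsto_nhds_unique (h1.congr fun t => ?_) h2
    simp [coordCLM_apply, coord_expDiag]
  · intro h
    have hg : Continuous fun s : ℝ => expDiag Φ M hC s.toNNReal y :=
      (continuous_expDiag_apply Φ hC y).comp continuous_real_toNNReal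
    have h1 : HasDerivAt (fun u : ℝ => ∫ s in (0 : ℝ)..u, expDiag Φ M hC s.toNNReal y)
        (expDiag Φ M hC (0 : ℝ).toNNReal y) 0 :=
      intervalIntegral.integral_hasDerivAt_right (hg.intervalIntegrable _ _)
        (hg.stronglyMeasurableAtFilter _ _) hg.continuousAt
    have h2 := tendsto_slope_nnreal h1
    rw [Real.toNNReal_zero, (isC0Semigroup_expDiag Φ hC).map_zero] at h2
    refine Tendsto.congr (fun t => ?_) h2
    congr 1
    refine ext_coord Φ fun k => ?_
    rw [intervalIntegral.integral_same, sub_zero, ← coordCLM_apply,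
      ← ContinuousLinearMap.intervalIntegral_comp_comm _ (hg.intervalIntegrable _ _),
      ← coordCLM_apply, map_sub, coordCLM_apply, coordCLM_apply, coord_expDiag]
    have h3 := intervalIntegral.integral_eq_sub_of_hasDerivAt (a := 0) (b := (t : ℝ))
      (fun s _ => hasDerivAt_exp_apply' (M k) (Φ x k) s)
      ((continuous_iff_continuousAt.2 fun s =>
        (hasDerivAt_exp_apply (M k) (M k (Φ x k)) s).continuousAt).intervalIntegrable _ _)
    simp only [exp_zero_smul_apply] at h3
    rw [← h3]
    refine intervalIntegral.integral_congr fun s hs => ?_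
    have hs0 : 0 ≤ s := (Set.uIcc_of_le (NNReal.coe_nonneg t) ▸ hs).1
    simp only [coordCLM_apply, coord_expDiag, Real.coe_toNNReal s hs0]
    rw [← h k]

lemma exists_generates_diagOp
    (hC : ∀ k, ∀ t : ℝ≥0, ‖NormedSpace.exp ((t : ℝ) • M k)‖ ≤ C) : ∃ S, Generates (diagOp Φ M) S :=
  ⟨_, isC0Semigroup_expDiag Φ hC, generator_expDiag Φ hC⟩

end BlockDiagonal

/-! ### Orbits of an arbitrary semigroup with block diagonal generator -/

section Uniqueness

variable {X : Type*} [NormedAddCommGroup X] [NormedSpace ℝ X] {S : ℝ≥0 → X →L[ℝ] X}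

lemma IsC0Semigroup.mem_generator (hS : IsC0Semigroup S) {x y : X} (h : (x, y) ∈ generator S)
    (t : ℝ≥0) : (S t x, S t y) ∈ generator S := by
  refine Tendsto.congr (fun s => ?_) (((S t).continuous.tendsto y).comp h)
  have h1 : S s (S t x) = S t (S s x) := by
    rw [← ContinuousLinearMap.comp_apply, ← hS.map_add, add_comm, hS.map_add]; rfl
  simp [h1]

lemma IsC0Semigroup.hasDerivWithinAt (hS : IsC0Semigroup S) {x y : X}
    (h : (x, y) ∈ generator S) {s : ℝ} (hs : 0 ≤ s) :
    HasDerivWithinAt (fun r : ℝ => S r.toNNReal x) (S s.toNNReal y) (Set.Ici s) s := by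
  rw [← hasDerivWithinAt_Ioi_iff_Ici, hasDerivWithinAt_iff_tendsto_slope' (by simp)]
  have h1 : Tendsto (fun r : ℝ => (r - s).toNNReal) (𝓝[>] s) (𝓝[>] 0) := by
    refine tendsto_nhdsWithin_iff.2 ⟨?_, ?_⟩
    · exact ((continuous_real_toNNReal.comp (continuous_id.sub continuous_const)).tendsto' s 0
        (by simp)).mono_left nhdsWithin_le_nhds
    · filter_upwards [self_mem_nhdsWithin] with r hr
      simpa using hr
  refine ((hS.mem_generator h s.toNNReal).comp h1).congr' ?_
  filter_upwards [self_mem_nhdsWithin] with r hr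
  have hr' : 0 ≤ r - s := sub_nonneg.2 (le_of_lt hr)
  have h2 : r.toNNReal = (r - s).toNNReal + s.toNNReal := by
    rw [← Real.toNNReal_add hr' hs, sub_add_cancel]
  rw [Function.comp_apply, slope_def_module, h2, hS.map_add, Real.coe_toNNReal _ hr']
  rfl

/-- Needed because `semigroupOf` is an unspecified choice. Elements of the domain suffice: the
vectors `P_n x` have finite support in the coordinates. -/
lemma Generates.coord_apply {V : Type*} [NormedAddCommGroup V] [NormedSpace ℝ V] [CompleteSpace V]
    (Φ : X ≃ₗᵢ[ℝ] lp (fun _ : ℕ => V) 2) {M : ℕ → V →L[ℝ] V} (hS : Generates (diagOp Φ M) S)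
    {p : X × X} (hp : p ∈ diagOp Φ M) (t : ℝ≥0) (k : ℕ) :
    Φ (S t p.1) k = NormedSpace.exp ((t : ℝ) • M k) (Φ p.1 k) := by
  obtain ⟨hC0, hgen⟩ := hS
  have hp' : (p.1, p.2) ∈ generator S := hgen ▸ hp
  have hcont : Continuous fun r : ℝ => Φ (S r.toNNReal p.1) k :=
    (coordCLM Φ k).continuous.comp ((hC0.continuous_apply p.1).comp continuous_real_toNNReal)
  -- The generator provides only right derivatives of the orbit, which is all that this uniqueness
  -- theorem requires.
  have key := ODE_solution_unique (v := fun _ => M k) (a := 0) (b := (t : ℝ))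
    (f := fun r : ℝ => Φ (S r.toNNReal p.1) k)
    (g := fun r : ℝ => NormedSpace.exp (r • M k) (Φ p.1 k))
    (fun _ => (M k).lipschitz) hcont.continuousOn
    (fun s hs => by
      have h1 : (S s.toNNReal p.1, S s.toNNReal p.2) ∈ diagOp Φ M :=
        hgen ▸ hC0.mem_generator hp' s.toNNReal
      rw [← h1 k]
      exact (coordCLM Φ k).hasFDerivAt.comp_hasDerivWithinAt s (hC0.hasDerivWithinAt hp' hs.1))
    (continuous_iff_continuousAt.2 fun s =>
        (hasDerivAt_exp_apply (M k) (Φ p.1 k) s).continuousAt).continuousOn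
    (fun s _ => (hasDerivAt_exp_apply (M k) (Φ p.1 k) s).hasDerivWithinAt)
    (by simp [hC0.map_zero])
  simpa using key ⟨t.2, le_rfl⟩

lemma generates_semigroupOf {G : Set (X × X)} (h : ∃ S : ℝ≥0 → X →L[ℝ] X, Generates G S) :
    Generates G (semigroupOf G) := by
  rw [semigroupOf, dif_pos h]
  exact h.choose_spec

end Uniqueness

/-! ### The small mass limit for a damped magnetic oscillator -/

section Oscillator

lemma le_of_hasDerivAt_nonpos {f f' : ℝ → ℝ} {T : ℝ} (hf : ∀ t ∈ Set.Icc 0 T, HasDerivAt f (f' t) t)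
    (hf' : ∀ t ∈ Set.Icc 0 T, f' t ≤ 0) {t : ℝ} (ht : t ∈ Set.Icc 0 T) : f t ≤ f 0 := by
  refine antitoneOn_of_deriv_nonpos (convex_Icc 0 T)
    (fun s hs => (hf s hs).continuousAt.continuousWithinAt)
    (fun s hs => (hf s (interior_subset hs)).differentiableAt.differentiableWithinAt)
    (fun s hs => ?_) ⟨le_rfl, ht.1.trans ht.2⟩ ht ht.1
  rw [(hf s (interior_subset hs)).deriv]
  exact hf' s (interior_subset hs)

lemma gronwallBound_le {δ K η x T : ℝ} (hK : 0 < K) (hδ : 0 ≤ δ) (hη : 0 ≤ η) (hxT : x ≤ T) :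
    gronwallBound δ K (K * η) x ≤ δ * Real.exp (K * T) + η * (Real.exp (K * T) - 1) := by
  rw [gronwallBound_of_K_ne_0 hK.ne', mul_div_cancel_left₀ _ hK.ne']
  beta_reduce
  gcongr

variable {F : Type*} [NormedAddCommGroup F] [InnerProductSpace ℝ F]

/-- `J` is a coercive operator with contractive inverse `K`. -/
structure IsFriction (ε : ℝ) (J K : F →L[ℝ] F) : Prop where
  coercive : ∀ v, ε * ‖v‖ ^ 2 ≤ inner ℝ v (J v)
  left_inv : ∀ v, K (J v) = v
  right_inv : ∀ v, J (K v) = v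
  norm_le : ∀ v, ‖K v‖ ≤ ‖v‖

variable {ε α μ T : ℝ} {J K : F →L[ℝ] F} {u w z : ℝ → F}

lemma IsFriction.norm_firstOrder_le (h : IsFriction ε J K) (hε : 0 < ε) (hα : 0 < α)
    (hz : ∀ t, HasDerivAt z (-(α • K (z t))) t) {t : ℝ} (ht : 0 ≤ t) : ‖z t‖ ≤ ‖z 0‖ := by
  refine (sq_le_sq₀ (norm_nonneg _) (norm_nonneg _)).1 ?_
  refine le_of_hasDerivAt_nonpos (f := fun s => ‖z s‖ ^ 2) (fun s _ => (hz s).norm_sq)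
    (fun s _ => ?_) ⟨ht, le_rfl⟩
  have h1 := h.coercive (K (z s))
  rw [h.right_inv, real_inner_comm] at h1
  have h2 : 0 ≤ inner ℝ (z s) (K (z s)) := le_trans (by positivity) h1
  rw [inner_neg_right, inner_smul_right]
  have := mul_nonneg hα.le h2
  linarith

/-- The cross terms `⟪u, w⟫` cancel, so the derivative of the energy is `-2 μ⁻² ⟪w, J w⟫`. -/
lemma IsFriction.energy_le (h : IsFriction ε J K) (hε : 0 < ε)
    (hu : ∀ t, HasDerivAt u (μ⁻¹ • w t) t)
    (hw : ∀ t, HasDerivAt w (-(μ⁻¹ • J (w t)) - α • u t) t) {t : ℝ} (ht : 0 ≤ t) :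
    α * ‖u t‖ ^ 2 + μ⁻¹ * ‖w t‖ ^ 2 ≤ α * ‖u 0‖ ^ 2 + μ⁻¹ * ‖w 0‖ ^ 2 := by
  refine le_of_hasDerivAt_nonpos (f := fun s => α * ‖u s‖ ^ 2 + μ⁻¹ * ‖w s‖ ^ 2)
    (fun s _ => ((hu s).norm_sq.const_mul α).add ((hw s).norm_sq.const_mul μ⁻¹))
    (fun s _ => ?_) ⟨ht, le_rfl⟩
  have h1 := h.coercive (w s)
  have h2 : 0 ≤ inner ℝ (w s) (J (w s)) := le_trans (by positivity) h1
  rw [inner_sub_right, inner_neg_right, inner_smul_right, inner_smul_right, inner_smul_right,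
    real_inner_comm (u s) (w s)]
  nlinarith [mul_nonneg (mul_self_nonneg μ⁻¹) h2]

/-- In `u + K w` the singular terms `μ⁻¹ w` cancel, since `K J = 1`. The difference to `z` starts at
`0` and is forced by `α K K w`, so Gronwall bounds it by `δ (exp(αT) - 1)`; removing `K w` costs one
more `δ`. -/
lemma IsFriction.norm_corrected_le (h : IsFriction ε J K) (hα : 0 < α)
    (hu : ∀ t, HasDerivAt u (μ⁻¹ • w t) t)
    (hw : ∀ t, HasDerivAt w (-(μ⁻¹ • J (w t)) - α • u t) t)
    (hz : ∀ t, HasDerivAt z (-(α • K (z t))) t) (h0 : u 0 + K (w 0) = z 0)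
    {δ : ℝ} (hδ : ∀ t ∈ Set.Icc 0 T, ‖w t‖ ≤ δ) {t : ℝ} (ht : t ∈ Set.Icc 0 T) :
    ‖u t - z t‖ ≤ δ * Real.exp (α * T) := by
  have hδ0 : 0 ≤ δ := (norm_nonneg _).trans (hδ t ht)
  have hq : ∀ t, HasDerivAt (fun s => u s + K (w s) - z s)
      (-(α • K ((u t + K (w t) - z t) - K (w t)))) t := fun t => by
    refine (((hu t).add (K.hasFDerivAt.comp_hasDerivAt t (hw t))).sub (hz t)).congr_deriv ?_
    simp only [map_sub, map_neg, map_smul, h.left_inv, map_add]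
    module
  have h1 := norm_le_gronwallBound_of_norm_deriv_right_le (δ := 0) (K := α) (ε := α * δ)
    (fun s _ => (hq s).continuousAt.continuousWithinAt) (fun s _ => (hq s).hasDerivWithinAt)
    (by simp [h0]) (fun s hs => by
      rw [norm_neg, norm_smul, Real.norm_of_nonneg hα.le, ← mul_add]
      gcongr
      refine (h.norm_le _).trans ((norm_sub_le _ _).trans ?_)
      gcongr
      exact (h.norm_le _).trans (hδ s ⟨hs.1, hs.2.le⟩)) t ht
  have h2 := h1.trans (gronwallBound_le hα le_rfl hδ0 (by simpa using ht.2))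
  have h3 : u t - z t = (u t + K (w t) - z t) - K (w t) := by abel
  rw [h3]
  refine (norm_sub_le _ _).trans ?_
  have h4 := (h.norm_le (w t)).trans (hδ t ht)
  linarith

/-- The limit `μ ↓ 0` for vanishing initial velocity. -/
lemma IsFriction.norm_sub_le_of_velocity_zero (h : IsFriction ε J K) (hε : 0 < ε) (hα : 0 < α)
    (hμ : 0 < μ) (hu : ∀ t, HasDerivAt u (μ⁻¹ • w t) t)
    (hw : ∀ t, HasDerivAt w (-(μ⁻¹ • J (w t)) - α • u t) t)
    (hz : ∀ t, HasDerivAt z (-(α • K (z t))) t) (hu0 : u 0 = z 0) (hw0 : w 0 = 0)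
    (hz0 : ‖z 0‖ ≤ 1) {t : ℝ} (ht : t ∈ Set.Icc 0 T) :
    ‖u t - z t‖ ≤ √(μ * α) * Real.exp (α * T) := by
  refine h.norm_corrected_le hα hu hw hz (by simp [hu0, hw0]) (fun s hs => ?_) ht
  refine Real.le_sqrt_of_sq_le ?_
  have h1 := h.energy_le hε hu hw hs.1
  have h2 : μ⁻¹ * ‖w s‖ ^ 2 ≤ α := by
    have h3 : ‖u 0‖ ^ 2 ≤ 1 := by
      rw [hu0]
      exact pow_le_one₀ (norm_nonneg _) hz0
    have h4 : 0 ≤ α * ‖u s‖ ^ 2 := by positivity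
    rw [hw0] at h1
    norm_num at h1
    nlinarith
  rwa [inv_mul_le_iff₀ hμ] at h2

/-- Coercivity damps `|w|²` at rate `2ε/μ`. Half of this absorbs the forcing `2αC|w|` by Young's
inequality, the other half gives the exponential decay. -/
lemma IsFriction.velocity_sq_le (h : IsFriction ε J K) (hε : 0 < ε) (hα : 0 < α) (hμ : 0 < μ)
    (hw : ∀ t, HasDerivAt w (-(μ⁻¹ • J (w t)) - α • u t) t)
    {C : ℝ} (hC : ∀ t ∈ Set.Icc 0 T, ‖u t‖ ≤ C) {t : ℝ} (ht : t ∈ Set.Icc 0 T) :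
    ‖w t‖ ^ 2 ≤ Real.exp (-(ε / μ * t)) * ‖w 0‖ ^ 2 + (μ * α * C / ε) ^ 2 := by
  -- The equilibrium of the comparison equation `r' = -(ε/μ) r + μα²C²/ε`.
  set R := (μ * α * C / ε) ^ 2 with hR
  have key : Real.exp (ε / μ * t) * (‖w t‖ ^ 2 - R) ≤
      Real.exp (ε / μ * 0) * (‖w 0‖ ^ 2 - R) := by
    refine le_of_hasDerivAt_nonpos (f := fun s => Real.exp (ε / μ * s) * (‖w s‖ ^ 2 - R))
      (fun s _ => (((hasDerivAt_id s).const_mul (ε / μ)).exp).mul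
        ((hw s).norm_sq.sub_const R)) (fun s hs => ?_) ht
    have h1 := h.coercive (w s)
    have h2 : -inner ℝ (w s) (u s) ≤ ‖w s‖ * C := by
      refine (neg_le_abs _).trans ((abs_real_inner_le_norm _ _).trans ?_)
      gcongr
      exact hC s hs
    have h3 : ε / μ * (‖w s‖ ^ 2 - R) +
        2 * inner ℝ (w s) (-(μ⁻¹ • J (w s)) - α • u s) ≤ 0 := by
      rw [inner_sub_right, inner_neg_right, inner_smul_right, inner_smul_right]
      have h5 : ε / μ * R = μ * α ^ 2 * C ^ 2 / ε := by rw [hR]; field_simp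
      have h6 : 2 * α * (‖w s‖ * C) ≤ ε / μ * ‖w s‖ ^ 2 + μ * α ^ 2 * C ^ 2 / ε := by
        have : ε / μ * ‖w s‖ ^ 2 + μ * α ^ 2 * C ^ 2 / ε - 2 * α * (‖w s‖ * C) =
            ε / μ * (‖w s‖ - μ * α * C / ε) ^ 2 := by field_simp; ring
        have h7 : 0 ≤ ε / μ * (‖w s‖ - μ * α * C / ε) ^ 2 := by positivity
        linarith
      have h8 : ε / μ * ‖w s‖ ^ 2 ≤ μ⁻¹ * inner ℝ (w s) (J (w s)) := by
        rw [div_eq_inv_mul, mul_assoc]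
        gcongr
      have h9 := mul_le_mul_of_nonneg_left h2 hα.le
      linarith
    have h4 := mul_nonpos_of_nonneg_of_nonpos (Real.exp_pos (ε / μ * s)).le h3
    simp only [id]
    linarith
  have h1 := mul_le_mul_of_nonneg_left key (Real.exp_pos (-(ε / μ * t))).le
  rw [← mul_assoc, ← Real.exp_add, neg_add_cancel, mul_zero, Real.exp_zero, one_mul, one_mul] at h1
  have h2 : 0 ≤ Real.exp (-(ε / μ * t)) * R := by positivity
  linarith

/-- The limit `μ ↓ 0` for vanishing initial position. -/
lemma IsFriction.norm_sub_le_of_position_zero (h : IsFriction ε J K) (hε : 0 < ε) (hα : 0 < α)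
    (hμ : 0 < μ) (hu : ∀ t, HasDerivAt u (μ⁻¹ • w t) t)
    (hw : ∀ t, HasDerivAt w (-(μ⁻¹ • J (w t)) - α • u t) t)
    (hz : ∀ t, HasDerivAt z (-(α • K (z t))) t) (hu0 : u 0 = 0) (hz0 : z 0 = K (w 0))
    (hw0 : ‖w 0‖ ≤ 1) {t₀ t : ℝ} (ht₀ : 0 ≤ t₀) (ht : t ∈ Set.Icc t₀ T) :
    ‖u t - z t‖ ≤ α * μ * ((3 + Real.exp (α * T)) * Real.exp (α * T)) +
      (1 + α * μ) * √(Real.exp (-(ε / μ * t₀)) + (μ * α * (1 + Real.exp (α * T)) / ε) ^ 2) := by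
  have ht' : t ∈ Set.Icc 0 T := ⟨ht₀.trans ht.1, ht.2⟩
  have hw1 : ∀ s ∈ Set.Icc 0 T, ‖w s‖ ≤ 1 := fun s hs => by
    have h1 := h.energy_le hε hu hw hs.1
    have h2 : μ⁻¹ * ‖w s‖ ^ 2 ≤ μ⁻¹ * ‖w 0‖ ^ 2 := by
      have : 0 ≤ α * ‖u s‖ ^ 2 := by positivity
      rw [hu0] at h1
      norm_num at h1
      linarith
    have h3 := le_of_mul_le_mul_left h2 (inv_pos.2 hμ)
    exact ((sq_le_sq₀ (norm_nonneg _) (norm_nonneg _)).1 h3).trans hw0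
  -- The first corrector with `δ = 1` gives no smallness here, but it bounds `u` independently of
  -- `μ`.
  have hu1 : ∀ s ∈ Set.Icc 0 T, ‖u s‖ ≤ 1 + Real.exp (α * T) := fun s hs => by
    have h1 := h.norm_corrected_le hα hu hw hz (by simp [hu0, hz0]) hw1 hs
    have h2 := h.norm_firstOrder_le hε hα hz hs.1
    rw [hz0] at h2
    have h3 := (h2.trans (h.norm_le _)).trans hw0
    have h4 := norm_add_le (u s - z s) (z s)
    rw [sub_add_cancel] at h4
    linarith
  have hK3 : ∀ v, ‖K (K (K v))‖ ≤ ‖v‖ := fun v =>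
    (h.norm_le _).trans ((h.norm_le _).trans (h.norm_le _))
  -- The term `αμ K³ w` is chosen so that the `-μ⁻¹ J w` part of `w'` contributes `-α K K w`, the
  -- opposite of the forcing left by the first corrector.
  have hp : ∀ t, HasDerivAt (fun s => u s + K (w s) - z s + (α * μ) • K (K (K (w s))))
      (-(α • K ((u t + K (w t) - z t + (α * μ) • K (K (K (w t)))) - (α * μ) • K (K (K (w t)))))
        + α • K (K (w t)) + (α * μ) • K (K (K (-(μ⁻¹ • J (w t)) - α • u t)))) t := fun t => by
    refine ((((hu t).add (K.hasFDerivAt.comp_hasDerivAt t (hw t))).sub (hz t)).add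
      (((K ∘L K ∘L K).hasFDerivAt.comp_hasDerivAt t (hw t)).const_smul (α * μ))).congr_deriv ?_
    simp only [map_sub, map_neg, map_smul, h.left_inv, map_add, ContinuousLinearMap.comp_apply]
    module
  have h1 := norm_le_gronwallBound_of_norm_deriv_right_le (δ := α * μ) (K := α)
    (ε := α * (α * μ * (2 + Real.exp (α * T))))
    (fun s _ => (hp s).continuousAt.continuousWithinAt) (fun s _ => (hp s).hasDerivWithinAt)
    (by
      rw [hu0, hz0, zero_add, sub_self, zero_add, norm_smul, Real.norm_of_nonneg (by positivity)]
      exact mul_le_of_le_one_right (by positivity) ((hK3 _).trans hw0)) (fun s hs => by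
      have hs' : s ∈ Set.Icc 0 T := ⟨hs.1, hs.2.le⟩
      set p := u s + K (w s) - z s + (α * μ) • K (K (K (w s)))
      -- After the cancellation only the forcing `α²μ (K⁴ w - K³ u)` remains, whose norm is at most
      -- `α²μ (2 + exp(αT))`.
      have h2 : -(α • K (p - (α * μ) • K (K (K (w s))))) + α • K (K (w s)) +
          (α * μ) • K (K (K (-(μ⁻¹ • J (w s)) - α • u s))) =
          -(α • K p) + (α * (α * μ)) • (K (K (K (K (w s)))) - K (K (K (u s)))) := by
        simp only [map_sub, map_neg, map_smul, h.left_inv]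
        have : (α * μ) • μ⁻¹ • K (K (w s)) = α • K (K (w s)) := by
          rw [smul_smul, mul_assoc, mul_inv_cancel₀ hμ.ne', mul_one]
        rw [smul_sub (α * μ), smul_neg, this]
        module
      rw [h2]
      refine (norm_add_le _ _).trans ?_
      rw [norm_neg, norm_smul, norm_smul, Real.norm_of_nonneg hα.le,
        Real.norm_of_nonneg (by positivity : 0 ≤ α * (α * μ)), ← mul_assoc α (α * μ)]
      gcongr
      · exact h.norm_le _
      · refine (norm_sub_le _ _).trans ?_
        have h3 := ((h.norm_le _).trans (hK3 (w s))).trans (hw1 s hs')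
        have h4 := (hK3 (u s)).trans (hu1 s hs')
        linarith) t ht'
  have h2 := h1.trans (gronwallBound_le (T := T) hα (by positivity) (by positivity)
    (by simpa using ht.2))
  have h3 : ‖w t‖ ≤ √(Real.exp (-(ε / μ * t₀)) + (μ * α * (1 + Real.exp (α * T)) / ε) ^ 2) := by
    refine Real.le_sqrt_of_sq_le ((h.velocity_sq_le hε hα hμ hw hu1 ht').trans ?_)
    gcongr
    have h4 : ‖w 0‖ ^ 2 ≤ 1 := pow_le_one₀ (norm_nonneg _) hw0
    refine (mul_le_of_le_one_right (Real.exp_pos _).le h4).trans ?_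
    gcongr
    exact ht.1
  have h4 : u t - z t = (u t + K (w t) - z t + (α * μ) • K (K (K (w t)))) - K (w t)
      - (α * μ) • K (K (K (w t))) := by abel
  rw [h4]
  refine (norm_sub_le _ _).trans ?_
  have h5 := norm_sub_le (u t + K (w t) - z t + (α * μ) • K (K (K (w t)))) (K (w t))
  have h6 : ‖(α * μ) • K (K (K (w t)))‖ ≤ α * μ * ‖w t‖ := by
    rw [norm_smul, Real.norm_of_nonneg (by positivity)]
    gcongr
    exact hK3 _
  have h7 := h.norm_le (w t)
  have h8 := mul_le_mul_of_nonneg_left h3 (by positivity : 0 ≤ 1 + α * μ)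
  have h9 : 0 ≤ α * μ * (2 + Real.exp (α * T)) := by positivity
  linarith

end Oscillator

/-! ### Spectral description of the Dirichlet Laplacian -/

section Spectral

variable {d : ℕ} {D : TopologicalSpace.Opens (EuclideanSpace ℝ (Fin d))}

lemma IsTest.gradient_memLp {φ : EuclideanSpace ℝ (Fin d) → ℝ} (h : IsTest D φ) :
    MemLp (gradient φ) 2 (vol D) := by
  have h1 : Continuous (gradient φ) :=
    (InnerProductSpace.toDual ℝ (EuclideanSpace ℝ (Fin d))).symm.continuous.comp
      (h.smooth.continuous_fderiv (by norm_num))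
  refine h1.memLp_of_hasCompactSupport ?_
  exact (h.compact.fderiv (𝕜 := ℝ)).comp_left
    (g := (InnerProductSpace.toDual ℝ (EuclideanSpace ℝ (Fin d))).symm) (map_zero _)

variable (D) in
/-- The graph of the gradient on `C_c^∞(D)`. -/
def testGrad : Submodule ℝ (L2 D × L2Grad D) where
  carrier := {p | ∃ φ : EuclideanSpace ℝ (Fin d) → ℝ,
    IsTest D φ ∧ p.1 =ᵐ[vol D] φ ∧ p.2 =ᵐ[vol D] gradient φ}
  add_mem' := by
    rintro a b ⟨φ, hφ, ha, ha'⟩ ⟨ψ, hψ, hb, hb'⟩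
    refine ⟨φ + ψ, ⟨hφ.smooth.add hψ.smooth, hφ.compact.add hψ.compact,
      (tsupport_add φ ψ).trans (Set.union_subset hφ.support hψ.support)⟩,
      (Lp.coeFn_add _ _).trans (ha.add hb), ?_⟩
    have h1 : gradient (φ + ψ) = gradient φ + gradient ψ := by
      funext x
      simp only [gradient, Pi.add_apply]
      rw [fderiv_add (hφ.smooth.differentiable (by norm_num) x)
        (hψ.smooth.differentiable (by norm_num) x), map_add]
    rw [h1]
    exact (Lp.coeFn_add _ _).trans (ha'.add hb')
  zero_mem' := by
    refine ⟨0, ⟨contDiff_const, HasCompactSupport.zero, by simp [tsupport]⟩,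
      Lp.coeFn_zero _ _ _, ?_⟩
    have h1 : gradient (0 : EuclideanSpace ℝ (Fin d) → ℝ) = 0 := by
      funext x
      simp [gradient]
    rw [h1]
    exact Lp.coeFn_zero _ _ _
  smul_mem' := by
    rintro c a ⟨φ, hφ, ha, ha'⟩
    refine ⟨c • φ, ⟨contDiff_const.smul hφ.smooth, hφ.compact.smul_left,
      (closure_mono (Function.support_const_smul_subset c φ)).trans hφ.support⟩,
      (Lp.coeFn_smul c _).trans (ha.const_smul c), ?_⟩
    have h1 : gradient (c • φ) = c • gradient φ := by
      funext x
      simp only [gradient, Pi.smul_apply]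
      rw [fderiv_const_smul (hφ.smooth.differentiable (by norm_num) x)]
      simp
    rw [h1]
    exact (Lp.coeFn_smul c _).trans (ha'.const_smul c)

/-- The weak equation is linear and continuous in `(φ, ∇φ)`, hence passes to the closure; this
allows testing with eigenfunctions, which need not be test functions. -/
lemma isDirichletLaplacian_iff_exists {u f : L2 D} :
    IsDirichletLaplacian D u f ↔ ∃ g : L2Grad D, (u, g) ∈ gradH10 D ∧
      ∀ p ∈ gradH10 D, inner ℝ g p.2 = - inner ℝ f p.1 := by
  have key : ∀ (g : L2Grad D) (p : L2 D × L2Grad D) (φ : EuclideanSpace ℝ (Fin d) → ℝ),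
      p.1 =ᵐ[vol D] φ → p.2 =ᵐ[vol D] gradient φ →
      inner ℝ g p.2 = ∫ x, inner ℝ (g x) (gradient φ x) ∂(vol D) ∧
      inner ℝ f p.1 = ∫ x, f x * φ x ∂(vol D) := by
    intro g p φ h1 h2
    rw [L2.inner_def, L2.inner_def]
    constructor
    · refine integral_congr_ae ?_
      filter_upwards [h2] with x hx
      rw [hx]
    · refine integral_congr_ae ?_
      filter_upwards [h1] with x hx
      rw [hx]
      simp [mul_comm]
  constructor
  · rintro ⟨g, hg, h⟩
    refine ⟨g, hg, fun p hp => ?_⟩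
    have hclosed : IsClosed {p : L2 D × L2Grad D | inner ℝ g p.2 = - inner ℝ f p.1} :=
      isClosed_eq (by fun_prop) (by fun_prop)
    refine closure_minimal ?_ hclosed hp
    rintro p ⟨φ, hφ, h1, h2⟩
    obtain ⟨h3, h4⟩ := key g p φ h1 h2
    rw [Set.mem_ofPred_eq, h3, h4, h φ hφ]
  · rintro ⟨g, hg, h⟩
    refine ⟨g, hg, fun φ hφ => ?_⟩
    obtain ⟨h3, h4⟩ := key g (hφ.memLp.toLp φ, hφ.gradient_memLp.toLp _) φ
      hφ.memLp.coeFn_toLp hφ.gradient_memLp.coeFn_toLp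
    rw [← h3, ← h4]
    exact h _ (subset_closure ⟨φ, hφ, hφ.memLp.coeFn_toLp, hφ.gradient_memLp.coeFn_toLp⟩)

namespace DirichletEigenbasis

variable (E : DirichletEigenbasis D)

lemma exists_grad (k : ℕ) : ∃ g : L2Grad D, (E.basis k, g) ∈ gradH10 D ∧
    ∀ p ∈ gradH10 D, inner ℝ g p.2 = E.eig k * inner ℝ (E.basis k) p.1 := by
  obtain ⟨g, hg, h⟩ := isDirichletLaplacian_iff_exists.1 (E.eigen k)
  refine ⟨g, hg, fun p hp => ?_⟩
  rw [h p hp, real_inner_smul_left]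
  ring

/-- The gradient of the `k`-th eigenfunction. -/
def grad (k : ℕ) : L2Grad D := (E.exists_grad k).choose

lemma grad_mem (k : ℕ) : (E.basis k, E.grad k) ∈ gradH10 D := (E.exists_grad k).choose_spec.1

lemma inner_grad (k : ℕ) {p : L2 D × L2Grad D} (hp : p ∈ gradH10 D) :
    inner ℝ (E.grad k) p.2 = E.eig k * inner ℝ (E.basis k) p.1 :=
  (E.exists_grad k).choose_spec.2 p hp

/-- The normalized gradients of the eigenfunctions. -/
def unitGrad (k : ℕ) : L2Grad D := (√(E.eig k))⁻¹ • E.grad k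

lemma inner_unitGrad (k : ℕ) {p : L2 D × L2Grad D} (hp : p ∈ gradH10 D) :
    inner ℝ (E.unitGrad k) p.2 = √(E.eig k) * inner ℝ (E.basis k) p.1 := by
  have h := Real.sqrt_pos.2 (E.eig_pos k)
  rw [unitGrad, real_inner_smul_left, E.inner_grad k hp]
  nth_rewrite 2 [← Real.mul_self_sqrt (E.eig_pos k).le]
  field_simp

/-- The weak eigenvalue equation gives `⟪∇ê_i, ∇ê_j⟫ = α̂_i δ_ij`. -/
lemma orthonormal_unitGrad : Orthonormal ℝ E.unitGrad := by
  rw [orthonormal_iff_ite]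
  intro i j
  have h := Real.sqrt_pos.2 (E.eig_pos j)
  have h1 := E.inner_unitGrad i (E.grad_mem j)
  have h2 := orthonormal_iff_ite.1 E.basis.orthonormal i j
  dsimp only at h1
  rw [h2] at h1
  rw [unitGrad.eq_1 E j, real_inner_smul_right, h1]
  split_ifs with hij
  · subst hij
    field_simp
  · simp

lemma grad_eq (k : ℕ) : E.grad k = √(E.eig k) • E.unitGrad k := by
  have h := Real.sqrt_pos.2 (E.eig_pos k)
  rw [unitGrad, smul_smul, mul_inv_cancel₀ h.ne', one_smul]

/-- The Dirichlet Laplacian is diagonal in the eigenbasis. -/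
lemma isDirichletLaplacian_iff {u f : L2 D} : IsDirichletLaplacian D u f ↔
    ∀ k, inner ℝ (E.basis k) f = -(E.eig k) * inner ℝ (E.basis k) u := by
  rw [isDirichletLaplacian_iff_exists]
  constructor
  · rintro ⟨g, hg, h⟩ k
    -- Green's identity: the equation of `u` is tested with `ê_k` and that of `ê_k` with `u`.
    have h1 := h _ (E.grad_mem k)
    have h2 := E.inner_grad k hg
    dsimp only at h1 h2
    rw [real_inner_comm] at h1
    rw [h1, real_inner_comm] at h2
    linarith
  · intro h
    -- The candidate gradient of `u`. The series converges since `α_k u_k² ≤ α_0⁻¹ (α_k u_k)² =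
    -- α_0⁻¹ f_k²`, where `u_k`, `f_k` are the coefficients of `u`, `f`.
    have hsum : Summable fun k => inner ℝ (E.basis k) u • E.grad k := by
      have h1 := E.orthonormal_unitGrad.orthogonalFamily.summable_iff_norm_sq_summable
        (fun k => inner ℝ (E.basis k) u * √(E.eig k))
      have h2 : Summable fun k => ‖inner ℝ (E.basis k) u * √(E.eig k)‖ ^ 2 := by
        refine Summable.of_nonneg_of_le (fun _ => by positivity) (fun k => ?_)
          ((E.basis.orthonormal.inner_products_summable f).mul_left (E.eig 0)⁻¹)
        have hk := E.eig_pos k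
        have h0 := E.eig_pos 0
        have h0k := E.eig_mono (Nat.zero_le k)
        rw [h k, norm_mul, norm_mul, norm_neg, mul_pow, mul_pow, Real.norm_of_nonneg hk.le,
          Real.norm_of_nonneg (Real.sqrt_nonneg _), Real.sq_sqrt hk.le, inv_mul_eq_div,
          le_div_iff₀ h0]
        have := mul_le_mul_of_nonneg_left h0k
          (by positivity : 0 ≤ ‖inner ℝ (E.basis k) u‖ ^ 2 * E.eig k)
        linarith
      refine (h1.2 h2).congr fun k => ?_
      simp [grad_eq, smul_smul]
    obtain ⟨g, hg⟩ := hsum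
    have hu : HasSum (fun k => inner ℝ (E.basis k) u • E.basis k) u := by
      simpa only [HilbertBasis.repr_apply_apply] using E.basis.hasSum_repr u
    refine ⟨g, ?_, fun p hp => ?_⟩
    · refine (isClosed_closure).mem_of_tendsto (hu.prodMk hg) (Eventually.of_forall fun s => ?_)
      refine (testGrad D).topologicalClosure.sum_mem fun k _ => ?_
      exact (testGrad D).topologicalClosure.smul_mem _ (E.grad_mem k)
    · have h1 := hg.mapL (innerSL ℝ p.2)
      have h2 := (E.basis.hasSum_inner_mul_inner p.1 f).neg
      rw [real_inner_comm, real_inner_comm p.1]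
      have h3 : ∀ k, innerSL ℝ p.2 (inner ℝ (E.basis k) u • E.grad k) =
          -(inner ℝ p.1 (E.basis k) * inner ℝ (E.basis k) f) := fun k => by
        rw [innerSL_apply_apply, real_inner_smul_right, real_inner_comm (E.grad k) p.2, E.inner_grad k hp, h k,
          real_inner_comm p.1]
        ring
      exact h1.unique (by simpa only [h3] using h2)

/-- Bessel's inequality as a continuous linear map into one of the components of `Seq2`. -/
def bessel (i : Fin 2) : L2Grad D →L[ℝ] Seq2 :=
  have hnorm : ∀ h k, ‖EuclideanSpace.single i (inner ℝ (E.unitGrad k) h : ℝ)‖ ^ 2 =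
      ‖(inner ℝ (E.unitGrad k) h : ℝ)‖ ^ 2 := fun h k => by
    rw [PiLp.norm_single]
  have hmem : ∀ h : L2Grad D,
      Memℓp (fun k => EuclideanSpace.single i (inner ℝ (E.unitGrad k) h : ℝ)) 2 := fun h =>
    memℓp_gen (by
      simpa using E.orthonormal_unitGrad.inner_products_summable h)
  LinearMap.mkContinuous
    { toFun := fun h => ⟨fun k => EuclideanSpace.single i (inner ℝ (E.unitGrad k) h : ℝ), hmem h⟩
      map_add' := fun g h => by
        ext1
        funext k
        change EuclideanSpace.single i (inner ℝ (E.unitGrad k) (g + h) : ℝ) =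
          EuclideanSpace.single i (inner ℝ (E.unitGrad k) g : ℝ) +
            EuclideanSpace.single i (inner ℝ (E.unitGrad k) h : ℝ)
        ext l
        rcases eq_or_ne l i with rfl | hl
        · simp [inner_add_right]
        · simp [hl]
      map_smul' := fun c h => by
        ext k j
        simp [inner_smul_right] }
    1 (fun h => by
      refine (sq_le_sq₀ (norm_nonneg _) (by positivity)).1 ?_
      rw [one_mul]
      have h1 := lp.hasSum_norm (p := 2) (by norm_num)
        (⟨fun k => EuclideanSpace.single i (inner ℝ (E.unitGrad k) h : ℝ), hmem h⟩ : Seq2)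
      simp only [ENNReal.toReal_ofNat, Real.rpow_ofNat, hnorm] at h1
      exact h1.tsum_eq ▸ E.orthonormal_unitGrad.tsum_inner_products_le h)

lemma bessel_apply (i : Fin 2) (h : L2Grad D) (k : ℕ) :
    E.bessel i h k = EuclideanSpace.single i (inner ℝ (E.unitGrad k) h : ℝ) := rfl

lemma Hs_eq_top {δ : ℝ}
    (h : ∀ (k : ℕ) (i : Fin 2), lp.single 2 k (EuclideanSpace.single i (1 : ℝ)) ∈ E.Hs δ) :
    E.Hs δ = ⊤ := by
  refine Submodule.eq_top_iff'.2 fun a => ?_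
  have hcl : IsClosed (E.Hs δ : Set Seq2) := Submodule.isClosed_topologicalClosure _
  refine hcl.mem_of_tendsto (lp.hasSum_single (p := 2) (by norm_num) a)
    (Eventually.of_forall fun s => ?_)
  refine (E.Hs δ).sum_mem fun k _ => ?_
  have h1 : lp.single 2 k (a k) = ∑ i : Fin 2, (a k i) •
      (lp.single 2 k (EuclideanSpace.single i (1 : ℝ)) : Seq2) := by
    have h2 : a k = ∑ i : Fin 2, (a k i) • EuclideanSpace.single i (1 : ℝ) := by
      ext j
      fin_cases j <;> simp
    conv_lhs => rw [h2]
    simp [lp.single_add, lp.single_smul]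
  rw [h1]
  exact (E.Hs δ).sum_mem fun i _ => (E.Hs δ).smul_mem _ (h k i)

lemma coef_single (i : Fin 2) (f : L2 D) (k : ℕ) :
    E.coef (PiLp.single 2 i f) k = EuclideanSpace.single i (inner ℝ (E.basis k) f) := by
  ext j
  rcases eq_or_ne j i with rfl | hj
  · simp [coef]
  · simp [coef, hj]

lemma Hs_neg_one : E.Hs (-1) = ⊤ := by
  refine E.Hs_eq_top fun k i => ?_
  have hk : E.eig k ^ (-(1 : ℝ) / 2) ≠ 0 := (Real.rpow_pos_of_pos (E.eig_pos k) _).ne'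
  have h1 : (lp.single 2 k (EuclideanSpace.single i (1 : ℝ)) : Seq2) =
      (E.eig k ^ (-(1 : ℝ) / 2))⁻¹ • E.toSeq (PiLp.single 2 i (E.basis k)) := by
    rw [eq_inv_smul_iff₀ hk]
    ext1
    funext j
    have h2 := orthonormal_iff_ite.1 E.basis.orthonormal j k
    simp only [toSeq_apply, coef_single, h2, lp.coeFn_smul, Pi.smul_apply]
    rcases eq_or_ne j k with rfl | hj
    · ext l; simp
    · ext l; simp [hj]
  rw [h1]
  exact (E.Hs (-1)).smul_mem _ (E.toSeq_mem _)

/-- For a test function the coefficients of `∇φ` along the unit gradients are `√α_k ⟪ê_k, φ⟫`,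
exactly the sequence representing `φ` in `H^1`. Continuity of `bessel` extends this to all of `H¹₀`,
in particular to eigenfunctions. -/
lemma bessel_mem {p : L2 D × L2Grad D} (hp : p ∈ gradH10 D) (i : Fin 2) :
    E.bessel i p.2 ∈ E.Hs 1 := by
  refine map_mem_closure (f := fun q : L2 D × L2Grad D => E.bessel i q.2)
    ((E.bessel i).continuous.comp continuous_snd) hp ?_
  rintro p ⟨φ, hφ, h1, h2⟩
  refine Submodule.subset_span ⟨PiLp.single 2 i p.1, fun j => ?_, fun k => ?_⟩
  · rcases eq_or_ne j i with rfl | hj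
    · exact ⟨φ, hφ, by simpa using h1⟩
    · refine ⟨0, ⟨contDiff_const, HasCompactSupport.zero, by simp [tsupport]⟩, ?_⟩
      simpa [hj] using Lp.coeFn_zero ℝ 2 (vol D)
  · rw [bessel_apply, E.inner_unitGrad k (subset_closure ⟨φ, hφ, h1, h2⟩),
      coef_single, Real.sqrt_eq_rpow]
    ext l
    rcases eq_or_ne l i with rfl | hl
    · simp
    · simp [hl]

lemma Hs_one : E.Hs 1 = ⊤ := by
  refine E.Hs_eq_top fun k i => ?_
  have hk : √(E.eig k) ≠ 0 := (Real.sqrt_pos.2 (E.eig_pos k)).ne'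
  have h1 : (lp.single 2 k (EuclideanSpace.single i (1 : ℝ)) : Seq2) =
      (√(E.eig k))⁻¹ • E.bessel i (E.grad k) := by
    rw [eq_inv_smul_iff₀ hk]
    ext1
    funext j
    have h2 := orthonormal_iff_ite.1 E.orthonormal_unitGrad j k
    rw [bessel_apply, grad_eq, real_inner_smul_right, h2, lp.coeFn_smul, Pi.smul_apply]
    rcases eq_or_ne j k with rfl | hj
    · ext l; simp
    · ext l; simp [hj]
  rw [h1]
  exact (E.Hs 1).smul_mem _ (E.bessel_mem (E.grad_mem k) i)

end DirichletEigenbasis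

end Spectral

/-! ### The matrices as operators -/

section MatrixAction

variable {F : Type*} [NormedAddCommGroup F] [NormedSpace ℝ F]

lemma matAct_apply (M : Matrix (Fin 2) (Fin 2) ℝ) (x : PiLp 2 fun _ : Fin 2 => F) (i : Fin 2) :
    matAct M x i = ∑ j, M i j • x j := rfl

lemma matAct_mul (M N : Matrix (Fin 2) (Fin 2) ℝ) (x : PiLp 2 fun _ : Fin 2 => F) :
    matAct M (matAct N x) = matAct (M * N) x := by
  ext1 i
  simp only [matAct_apply, Matrix.mul_apply, Fin.sum_univ_two]
  module

lemma matAct_one (x : PiLp 2 fun _ : Fin 2 => F) : matAct 1 x = x := by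
  ext1 i
  fin_cases i <;> simp [matAct_apply]

lemma isUnit_det_Jmat (ε : ℝ) : IsUnit (Jmat ε).det := by
  rw [isUnit_iff_ne_zero, Jmat, Matrix.det_fin_two_of]
  nlinarith [mul_self_nonneg ε]

lemma matAct_Jmat_inv_cancel (ε : ℝ) (x : PiLp 2 fun _ : Fin 2 => F) :
    matAct (Jmat ε)⁻¹ (matAct (Jmat ε) x) = x := by
  rw [matAct_mul, Matrix.nonsing_inv_mul _ (isUnit_det_Jmat ε), matAct_one]

lemma matAct_Jmat_cancel_inv (ε : ℝ) (x : PiLp 2 fun _ : Fin 2 => F) :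
    matAct (Jmat ε) (matAct (Jmat ε)⁻¹ x) = x := by
  rw [matAct_mul, Matrix.mul_nonsing_inv _ (isUnit_det_Jmat ε), matAct_one]

/-- The action of a matrix on `ℝ²` as a continuous linear map. -/
def matActCLM (M : Matrix (Fin 2) (Fin 2) ℝ) :
    EuclideanSpace ℝ (Fin 2) →L[ℝ] EuclideanSpace ℝ (Fin 2) :=
  LinearMap.toContinuousLinearMap
    { toFun := matAct M
      map_add' := fun x y => by
        ext1 i
        simp [matAct_apply, mul_add, Finset.sum_add_distrib]
      map_smul' := fun c x => by
        ext1 i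
        simp [matAct_apply, mul_left_comm]
        ring }

lemma matActCLM_apply (M : Matrix (Fin 2) (Fin 2) ℝ) (x : EuclideanSpace ℝ (Fin 2)) :
    matActCLM M x = matAct M x := rfl

/-- The skew part of `J_ε` drops out of `⟪v, J_ε v⟫`, and `|J_ε v|² = (1 + ε²)|v|² ≥ |v|²` makes the
inverse contractive. -/
lemma isFriction_Jmat (ε : ℝ) : IsFriction ε (matActCLM (Jmat ε)) (matActCLM (Jmat ε)⁻¹) where
  coercive v := by
    refine le_of_eq ?_
    simp [EuclideanSpace.norm_sq_eq, PiLp.inner_apply, matActCLM_apply, matAct_apply, Jmat]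
    ring
  left_inv v := matAct_Jmat_inv_cancel ε v
  right_inv v := matAct_Jmat_cancel_inv ε v
  norm_le v := by
    have h1 : ∀ x : EuclideanSpace ℝ (Fin 2), ‖x‖ ≤ ‖matAct (Jmat ε) x‖ := fun x => by
      refine (sq_le_sq₀ (norm_nonneg _) (norm_nonneg _)).1 ?_
      simp [EuclideanSpace.norm_sq_eq, matAct_apply, Jmat]
      nlinarith [mul_self_nonneg (ε * x 0), mul_self_nonneg (ε * x 1)]
    have h2 := h1 (matAct (Jmat ε)⁻¹ v)
    rwa [matAct_Jmat_cancel_inv] at h2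

end MatrixAction

/-! ### Vectors with finitely many nonzero coordinates -/

section BlockDiagonal

variable {V : Type*} [NormedAddCommGroup V]

lemma sum_single_apply (f : ℕ → V) (n k : ℕ) :
    (∑ j ∈ Finset.range n, lp.single 2 j (f j) : lp (fun _ : ℕ => V) 2) k =
      if k < n then f k else 0 := by
  rw [lp.coeFn_sum, Finset.sum_apply]
  simp only [lp.single_apply, Pi.single_apply]
  simp

variable [NormedSpace ℝ V]
  {X : Type*} [NormedAddCommGroup X] [NormedSpace ℝ X]
  (Φ : X ≃ₗᵢ[ℝ] lp (fun _ : ℕ => V) 2) (M : ℕ → V →L[ℝ] V)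

lemma exists_mem_diagOp {x : X} {n : ℕ} (hx : ∀ k, n ≤ k → Φ x k = 0) :
    ∃ y, (x, y) ∈ diagOp Φ M := by
  refine ⟨Φ.symm (∑ j ∈ Finset.range n, lp.single 2 j (M j (Φ x j))), fun k => ?_⟩
  rw [LinearIsometryEquiv.apply_symm_apply, sum_single_apply]
  split_ifs with h
  · rfl
  · rw [hx k (not_lt.1 h), map_zero]

/-- A crude `ℓ¹` bound; with `n` fixed it transfers blockwise limits to the norm, uniformly in the
data. -/
lemma norm_le_sum_of_coord {x : X} {n : ℕ} {B : ℕ → ℝ} (hx : ∀ k, n ≤ k → Φ x k = 0)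
    (hB : ∀ k, k < n → ‖Φ x k‖ ≤ B k) : ‖x‖ ≤ ∑ k ∈ Finset.range n, B k := by
  have h1 : Φ x = ∑ j ∈ Finset.range n, lp.single 2 j (Φ x j) := by
    ext k
    rw [sum_single_apply]
    split_ifs with h
    · rfl
    · exact hx k (not_lt.1 h)
  rw [← Φ.norm_map, h1]
  refine (norm_sum_le _ _).trans (Finset.sum_le_sum fun k hk => ?_)
  rw [lp.norm_single (by norm_num)]
  exact hB k (Finset.mem_range.1 hk)

end BlockDiagonal

/-! ### The coordinate systems -/

section Coordinates

variable {d : ℕ} {D : TopologicalSpace.Opens (EuclideanSpace ℝ (Fin d))}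

namespace DirichletEigenbasis

variable (E : DirichletEigenbasis D)

lemma coef_matAct (M : Matrix (Fin 2) (Fin 2) ℝ) (u : HSpace D) (k : ℕ) :
    E.coef (matAct M u) k = matAct M (E.coef u k) := by
  ext1 i
  simp [coef, matAct_apply, inner_add_right, inner_smul_right]

lemma coef_add (u v : HSpace D) (k : ℕ) : E.coef (u + v) k = E.coef u k + E.coef v k := by
  ext1 i
  simp [coef, inner_add_right]

lemma coef_smul (c : ℝ) (u : HSpace D) (k : ℕ) : E.coef (c • u) k = c • E.coef u k := by
  ext1 i
  simp [coef, inner_smul_right]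

lemma norm_coef_le (u : HSpace D) (k : ℕ) : ‖E.coef u k‖ ≤ ‖u‖ :=
  (sq_le_sq₀ (norm_nonneg _) (norm_nonneg _)).1
    (le_hasSum (E.hasSum_norm_coef_sq u) k fun _ _ => sq_nonneg _)

/-- `u ↦ (⟪u, e_k⟫)_k` as an isometry of `H` onto `ℓ²`. -/
def coefEquiv : HSpace D ≃ₗᵢ[ℝ] Seq2 :=
  LinearIsometryEquiv.ofSurjective
    { toFun := fun u => ⟨fun k => E.coef u k,
        memℓp_gen (by simpa using (E.hasSum_norm_coef_sq u).summable)⟩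
      map_add' := fun u v => by ext1; funext k; exact E.coef_add u v k
      map_smul' := fun c u => by ext1; funext k; exact E.coef_smul c u k
      norm_map' := fun u => by
        refine (sq_eq_sq₀ (norm_nonneg _) (norm_nonneg _)).1 ?_
        have h := lp.hasSum_norm (p := 2) (by norm_num) (⟨fun k => E.coef u k,
          memℓp_gen (by simpa using (E.hasSum_norm_coef_sq u).summable)⟩ : Seq2)
        simp only [ENNReal.toReal_ofNat, Real.rpow_ofNat] at h
        exact h.unique (E.hasSum_norm_coef_sq u) }
    (fun a => by
      have ha : Summable fun k => ‖a k‖ ^ 2 := by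
        simpa using (lp.hasSum_norm (p := 2) (by norm_num) a).summable
      have hmem : ∀ i : Fin 2, Memℓp (fun k => a k i) 2 := fun i => by
        refine memℓp_gen (Summable.of_nonneg_of_le (fun _ => by positivity) (fun k => ?_) ha)
        simp only [ENNReal.toReal_ofNat, Real.rpow_ofNat]
        gcongr
        exact PiLp.norm_apply_le _ _
      refine ⟨WithLp.toLp 2 fun i => E.basis.repr.symm ⟨fun k => a k i, hmem i⟩, ?_⟩
      ext k i
      change inner ℝ (E.basis k) (E.basis.repr.symm ⟨fun k => a k i, hmem i⟩) = a k i
      rw [← HilbertBasis.repr_apply_apply, LinearIsometryEquiv.apply_symm_apply])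

lemma coefEquiv_apply (u : HSpace D) (k : ℕ) : E.coefEquiv u k = E.coef u k := rfl

/-- The fibres of the phase space. -/
abbrev Block : Type := WithLp 2 (EuclideanSpace ℝ (Fin 2) × EuclideanSpace ℝ (Fin 2))

/-- The coordinates on the phase space, normalized so as to give an isometry onto `ℓ²`. -/
def phaseEquiv : E.Phase ≃ₗᵢ[ℝ] lp (fun _ : ℕ => Block) 2 :=
  have hsum : ∀ p : E.Phase, HasSum
      (fun k => ‖(WithLp.toLp 2 (E.coef p.fst k, (p.snd : Seq2) k) : Block)‖ ^ 2)
      (‖p‖ ^ 2) := fun p => by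
    have h := lp.hasSum_norm (p := 2) (by norm_num) (p.snd : Seq2)
    simp only [ENNReal.toReal_ofNat, Real.rpow_ofNat] at h
    simp only [WithLp.prod_norm_sq_eq_of_L2]
    exact (E.hasSum_norm_coef_sq p.fst).add h
  have hmem : ∀ p : E.Phase,
      Memℓp (fun k => (WithLp.toLp 2 (E.coef p.fst k, (p.snd : Seq2) k) : Block)) 2 := fun p =>
    memℓp_gen (by simpa using (hsum p).summable)
  LinearIsometryEquiv.ofSurjective
    { toFun := fun p =>
        ⟨fun k => WithLp.toLp 2 (E.coef p.fst k, (p.snd : Seq2) k), hmem p⟩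
      map_add' := fun p q => by
        ext1
        funext k
        change WithLp.toLp 2 (E.coef (p.fst + q.fst) k, _) = _
        rw [E.coef_add]
        rfl
      map_smul' := fun c p => by
        ext1
        funext k
        change WithLp.toLp 2 (E.coef (c • p.fst) k, _) = _
        rw [E.coef_smul]
        rfl
      norm_map' := fun p => by
        refine (sq_eq_sq₀ (norm_nonneg _) (norm_nonneg _)).1 ?_
        have h := lp.hasSum_norm (p := 2) (by norm_num) (⟨fun k => WithLp.toLp 2
          (E.coef p.fst k, (p.snd : Seq2) k), hmem p⟩ : lp (fun _ : ℕ => Block) 2)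
        simp only [ENNReal.toReal_ofNat, Real.rpow_ofNat] at h
        exact h.unique (hsum p) }
    (fun a => by
      have ha : Summable fun k => ‖a k‖ ^ 2 := by
        simpa using (lp.hasSum_norm (p := 2) (by norm_num) a).summable
      have hle : ∀ k, ‖(a k).fst‖ ^ 2 ≤ ‖a k‖ ^ 2 ∧ ‖(a k).snd‖ ^ 2 ≤ ‖a k‖ ^ 2 := fun k => by
        rw [WithLp.prod_norm_sq_eq_of_L2]
        constructor <;> nlinarith [sq_nonneg ‖(a k).fst‖, sq_nonneg ‖(a k).snd‖]
      have h1 : Memℓp (fun k => (a k).fst) 2 := memℓp_gen (by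
        simpa using Summable.of_nonneg_of_le (fun _ => by positivity) (fun k => (hle k).1) ha)
      have h2 : Memℓp (fun k => (a k).snd) 2 := memℓp_gen (by
        simpa using Summable.of_nonneg_of_le (fun _ => by positivity) (fun k => (hle k).2) ha)
      -- Surjectivity is where the density behind `Hs_neg_one` enters.
      have h3 : ∀ s : Seq2, s ∈ E.Hs (-1) := fun s => by rw [E.Hs_neg_one]; trivial
      refine ⟨WithLp.toLp 2 (E.coefEquiv.symm ⟨_, h1⟩, ⟨⟨_, h2⟩, h3 _⟩), ?_⟩
      ext1
      funext k
      change WithLp.toLp 2 (E.coefEquiv (E.coefEquiv.symm ⟨_, h1⟩) k, (a k).snd) = a k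
      rw [LinearIsometryEquiv.apply_symm_apply]
      rfl)

lemma phaseEquiv_apply (p : E.Phase) (k : ℕ) :
    E.phaseEquiv p k = WithLp.toLp 2 (E.coef p.fst k, (p.snd : Seq2) k) := rfl

/-! ### The two operators in coordinates -/

lemma firstOrderOp_eq (ε : ℝ) : firstOrderOp D ε =
    diagOp E.coefEquiv fun k => -(E.eig k) • matActCLM (Jmat ε)⁻¹ := by
  have hcoef : ∀ u f : HSpace D, (∀ i, IsDirichletLaplacian D (u i) (f i)) ↔
      ∀ k, E.coef f k = -(E.eig k) • E.coef u k := fun u f => by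
    simp only [E.isDirichletLaplacian_iff]
    constructor
    · intro h k
      ext1 i
      exact h i k
    · intro h i k
      exact congrArg (fun v : EuclideanSpace ℝ (Fin 2) => v i) (h k)
  ext ⟨u, y⟩
  constructor
  · rintro ⟨f, hf, rfl : y = _⟩ k
    have h1 := (hcoef _ _).1 hf k
    simp only [coefEquiv_apply, coef_matAct, smul_apply]
    rw [← matActCLM_apply, h1, map_smul]
  · intro h
    refine ⟨matAct (Jmat ε) y, (hcoef _ _).2 fun k => ?_, (matAct_Jmat_inv_cancel ε y).symm⟩
    have h1 := h k
    simp only [coefEquiv_apply, smul_apply] at h1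
    rw [coef_matAct, ← matActCLM_apply, h1, map_smul, (isFriction_Jmat ε).right_inv]

/-- The blocks of `A_μ^ε`. -/
def secondOrderBlock (ε μ : ℝ) (k : ℕ) : Block →L[ℝ] Block :=
  ((WithLp.prodContinuousLinearEquiv 2 ℝ (EuclideanSpace ℝ (Fin 2))
    (EuclideanSpace ℝ (Fin 2))).symm : _ →L[ℝ] _) ∘L
  ((√(E.eig k) • ContinuousLinearMap.snd ℝ _ _).prod
    (-(μ⁻¹ • (√(E.eig k) • ContinuousLinearMap.fst ℝ _ _ +
      matActCLM (Jmat ε) ∘L ContinuousLinearMap.snd ℝ _ _)))) ∘L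
  (WithLp.prodContinuousLinearEquiv 2 ℝ (EuclideanSpace ℝ (Fin 2))
    (EuclideanSpace ℝ (Fin 2)) : _ →L[ℝ] _)

lemma secondOrderBlock_apply (ε μ : ℝ) (k : ℕ) (b : Block) :
    E.secondOrderBlock ε μ k b = WithLp.toLp 2 (√(E.eig k) • b.snd,
      -(μ⁻¹ • (√(E.eig k) • b.fst + matActCLM (Jmat ε) b.snd))) := rfl

lemma secondOrderBlock_toLp (ε μ : ℝ) (k : ℕ) (c b : EuclideanSpace ℝ (Fin 2)) :
    E.secondOrderBlock ε μ k (WithLp.toLp 2 (c, b)) = WithLp.toLp 2 (√(E.eig k) • b,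
      -(μ⁻¹ • (√(E.eig k) • c + matActCLM (Jmat ε) b))) := rfl

lemma sqrt_eig_pos (k : ℕ) : 0 < √(E.eig k) := Real.sqrt_pos.2 (E.eig_pos k)

lemma rpow_neg_half (k : ℕ) : E.eig k ^ (-(1 : ℝ) / 2) = (√(E.eig k))⁻¹ := by
  rw [Real.sqrt_eq_rpow, ← Real.rpow_neg (E.eig_pos k).le]
  norm_num

lemma hsCoef_neg_one (a : E.Hs (-1)) (k : ℕ) : E.hsCoef a k = √(E.eig k) • (a : Seq2) k := by
  rw [hsCoef, Real.sqrt_eq_rpow]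
  norm_num

lemma hsCoef_one (a : E.Hs 1) (k : ℕ) : E.hsCoef a k = (√(E.eig k))⁻¹ • (a : Seq2) k := by
  rw [hsCoef, ← E.rpow_neg_half]
  norm_num

lemma emb_apply (v : HSpace D) (k : ℕ) :
    (E.emb v : Seq2) k = (√(E.eig k))⁻¹ • E.coef v k := by
  rw [← E.rpow_neg_half]
  rfl

/-- A velocity `v` is stored in `H^{-1}` as `b_k = α_k^(-1/2) v_k`, whence the factors `√α_k` in the
blocks. The domain conditions come for free: the first block row says that `√α_k b_k` is the
coefficient sequence of an element of `H`, and the second puts `u` in `H^1`. -/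
lemma secondOrderOp_eq (ε : ℝ) {μ : ℝ} (hμ : 0 < μ) : E.secondOrderOp ε μ =
    diagOp E.phaseEquiv (E.secondOrderBlock ε μ) := by
  ext ⟨p, q⟩
  constructor
  · rintro ⟨-, v, hv, hqv, hq⟩ k
    have hs := (E.sqrt_eig_pos k).ne'
    dsimp only at hv hqv hq
    have h1 := hq k
    rw [hsCoef_neg_one] at h1
    rw [phaseEquiv_apply, phaseEquiv_apply, secondOrderBlock_toLp]
    rw [hv, hqv, emb_apply, smul_smul, mul_inv_cancel₀ hs, one_smul, map_smul]
    congr 2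
    rw [← matActCLM_apply] at h1
    rw [← inv_smul_smul₀ hs ((q.snd : Seq2) k), h1]
    have h2 : E.eig k = √(E.eig k) * √(E.eig k) := (Real.mul_self_sqrt (E.eig_pos k).le).symm
    rw [smul_comm, ← smul_neg]
    congr 1
    rw [smul_sub, smul_smul]
    nth_rewrite 2 [h2]
    have h3 : (√(E.eig k))⁻¹ * -(√(E.eig k) * √(E.eig k)) = -√(E.eig k) := by
      field_simp
    rw [h3]
    module
  · intro h
    have h1 : ∀ k, E.coef q.fst k = √(E.eig k) • (p.snd : Seq2) k := fun k =>
      congrArg WithLp.fst (h k)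
    have h2 : ∀ k, (q.snd : Seq2) k = -(μ⁻¹ • (√(E.eig k) • E.coef p.fst k +
        matActCLM (Jmat ε) ((p.snd : Seq2) k))) := fun k => congrArg WithLp.snd (h k)
    have h3 : ∀ s : Seq2, s ∈ E.Hs 1 := fun s => by rw [E.Hs_one]; trivial
    -- The representative of `u` in `H^1`, found by solving the second block row for `√α_k u_k`:
    -- both terms are square summable.
    refine ⟨⟨⟨-(μ • (q.snd : Seq2)) - lpDiag (fun _ => matActCLM (Jmat ε)) _ (fun _ => le_rfl)
      (p.snd : Seq2), h3 _⟩, fun k => ?_⟩, q.fst, ?_, rfl, fun k => ?_⟩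
    · have hs := (E.sqrt_eig_pos k).ne'
      rw [hsCoef_one, inv_smul_eq_iff₀ hs]
      change -(μ • (q.snd : Seq2) k) - matActCLM (Jmat ε) ((p.snd : Seq2) k) = _
      rw [h2, smul_neg, smul_smul, mul_inv_cancel₀ hμ.ne']
      module
    · ext1
      ext1
      funext k
      rw [emb_apply, h1, inv_smul_smul₀ (E.sqrt_eig_pos k).ne']
    · rw [hsCoef_neg_one, h2, h1, ← matActCLM_apply, map_smul]
      have h4 : E.eig k = √(E.eig k) * √(E.eig k) := (Real.mul_self_sqrt (E.eig_pos k).le).symm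
      nth_rewrite 3 [h4]
      module

end DirichletEigenbasis
end Coordinates

/-! ### The semigroups and the small mass limit -/

section SmallMass

variable {d : ℕ} {D : TopologicalSpace.Opens (EuclideanSpace ℝ (Fin d))}

namespace DirichletEigenbasis

variable (E : DirichletEigenbasis D)

lemma hasDerivAt_firstOrderBlock (ε : ℝ) (k : ℕ) (v : EuclideanSpace ℝ (Fin 2)) (t : ℝ) :
    HasDerivAt (fun s : ℝ => NormedSpace.exp (s • (-(E.eig k) • matActCLM (Jmat ε)⁻¹)) v)
      (-(E.eig k • matActCLM (Jmat ε)⁻¹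
        (NormedSpace.exp (t • (-(E.eig k) • matActCLM (Jmat ε)⁻¹)) v))) t :=
  (hasDerivAt_exp_apply (-(E.eig k) • matActCLM (Jmat ε)⁻¹) v t).congr_deriv
    (neg_smul (E.eig k) (matActCLM (Jmat ε)⁻¹
      (NormedSpace.exp (t • (-(E.eig k) • matActCLM (Jmat ε)⁻¹)) v)))

lemma norm_exp_firstOrderBlock_le {ε : ℝ} (hε : 0 < ε) (k : ℕ) (t : ℝ≥0) :
    ‖NormedSpace.exp ((t : ℝ) • (-(E.eig k) • matActCLM (Jmat ε)⁻¹))‖ ≤ 1 := by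
  refine ContinuousLinearMap.opNorm_le_bound _ zero_le_one fun v => ?_
  rw [one_mul]
  have h := (isFriction_Jmat ε).norm_firstOrder_le hε (E.eig_pos k)
    (E.hasDerivAt_firstOrderBlock ε k v) t.2
  exact h.trans_eq (congrArg norm (exp_zero_smul_apply _ v))

lemma generates_firstOrder (E : DirichletEigenbasis D) {ε : ℝ} (hε : 0 < ε) :
    Generates (firstOrderOp D ε) (firstOrderSemigroup D ε) := by
  refine generates_semigroupOf ?_
  rw [E.firstOrderOp_eq]
  exact exists_generates_diagOp E.coefEquiv (E.norm_exp_firstOrderBlock_le hε)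

/-- The orbits of the blocks of `A_μ^ε`: the position. -/
def pos (ε μ : ℝ) (k : ℕ) (b : Block) (t : ℝ) : EuclideanSpace ℝ (Fin 2) :=
  (NormedSpace.exp (t • E.secondOrderBlock ε μ k) b).fst

/-- The orbits of the blocks of `A_μ^ε`: the momentum. -/
def momentum (ε μ : ℝ) (k : ℕ) (b : Block) (t : ℝ) : EuclideanSpace ℝ (Fin 2) :=
  (μ * √(E.eig k)) • (NormedSpace.exp (t • E.secondOrderBlock ε μ k) b).snd

lemma pos_zero (ε μ : ℝ) (k : ℕ) (b : Block) : E.pos ε μ k b 0 = b.fst :=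
  congrArg WithLp.fst (exp_zero_smul_apply _ b)

lemma momentum_zero (ε μ : ℝ) (k : ℕ) (b : Block) :
    E.momentum ε μ k b 0 = (μ * √(E.eig k)) • b.snd :=
  congrArg (fun c : Block => (μ * √(E.eig k)) • c.snd) (exp_zero_smul_apply _ b)

lemma hasDerivAt_pos (ε : ℝ) {μ : ℝ} (hμ : 0 < μ) (k : ℕ) (b : Block) (t : ℝ) :
    HasDerivAt (E.pos ε μ k b) (μ⁻¹ • E.momentum ε μ k b t) t := by
  have h := (WithLp.fstL 2 ℝ (EuclideanSpace ℝ (Fin 2)) (EuclideanSpace ℝ (Fin 2))).hasFDerivAt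
    |>.comp_hasDerivAt t (hasDerivAt_exp_apply (E.secondOrderBlock ε μ k) b t)
  refine h.congr_deriv ?_
  rw [momentum, smul_smul, inv_mul_cancel_left₀ hμ.ne', secondOrderBlock_apply]
  rfl

lemma hasDerivAt_momentum (ε : ℝ) {μ : ℝ} (hμ : 0 < μ) (k : ℕ) (b : Block) (t : ℝ) :
    HasDerivAt (E.momentum ε μ k b) (-(μ⁻¹ • matActCLM (Jmat ε) (E.momentum ε μ k b t)) -
      E.eig k • E.pos ε μ k b t) t := by
  have h := ((WithLp.sndL 2 ℝ (EuclideanSpace ℝ (Fin 2)) (EuclideanSpace ℝ (Fin 2))).hasFDerivAt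
    |>.comp_hasDerivAt t (hasDerivAt_exp_apply (E.secondOrderBlock ε μ k) b t)).const_smul
      (μ * √(E.eig k))
  refine h.congr_deriv ?_
  rw [secondOrderBlock_apply, momentum, pos]
  change (μ * √(E.eig k)) • -(μ⁻¹ • (√(E.eig k) • _ + matActCLM (Jmat ε) _)) = _
  rw [map_smul]
  have h4 : E.eig k = √(E.eig k) * √(E.eig k) := (Real.mul_self_sqrt (E.eig_pos k).le).symm
  have h6 : μ * √(E.eig k) * μ⁻¹ = √(E.eig k) := by field_simp
  have h7 : μ⁻¹ * (μ * √(E.eig k)) = √(E.eig k) := by field_simp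
  rw [smul_neg, smul_smul, smul_smul, h6, h7, smul_add, smul_smul, ← h4, neg_add_rev]
  rfl

/-- With momentum `μ√α_k b` the energy equals `α_k (|u|² + μ|b|²)`. The factor `α_k` cancels, so the
bound is uniform in `k`; its dependence on `μ` is harmless, as it only serves generation. -/
lemma norm_exp_secondOrderBlock_le {ε μ : ℝ} (hε : 0 < ε) (hμ : 0 < μ) (k : ℕ) (t : ℝ≥0) :
    ‖NormedSpace.exp ((t : ℝ) • E.secondOrderBlock ε μ k)‖ ≤ √(max 1 μ / min 1 μ) := by
  refine ContinuousLinearMap.opNorm_le_bound _ (Real.sqrt_nonneg _) fun b => ?_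
  have h := (isFriction_Jmat ε).energy_le hε (E.hasDerivAt_pos ε hμ k b)
    (E.hasDerivAt_momentum ε hμ k b) t.2
  have hα := E.eig_pos k
  have hsq : ∀ x : EuclideanSpace ℝ (Fin 2), μ⁻¹ * ‖(μ * √(E.eig k)) • x‖ ^ 2 =
      E.eig k * (μ * ‖x‖ ^ 2) := fun x => by
    rw [norm_smul, Real.norm_of_nonneg (by positivity), mul_pow, mul_pow, Real.sq_sqrt hα.le]
    field_simp
  rw [pos_zero, momentum_zero, momentum, hsq, hsq, ← mul_add, ← mul_add] at h
  have h1 := le_of_mul_le_mul_left h hα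
  rw [pos] at h1
  set y := NormedSpace.exp ((t : ℝ) • E.secondOrderBlock ε μ k) b with hy
  change ‖y.fst‖ ^ 2 + μ * ‖y.snd‖ ^ 2 ≤ _ at h1
  have hm : 0 < min 1 μ := lt_min one_pos hμ
  have h2 : min 1 μ * ‖y‖ ^ 2 ≤ max 1 μ * ‖b‖ ^ 2 := by
    rw [WithLp.prod_norm_sq_eq_of_L2, WithLp.prod_norm_sq_eq_of_L2, mul_add, mul_add]
    have a1 := mul_le_mul_of_nonneg_right (min_le_left 1 μ) (sq_nonneg ‖y.fst‖)
    have a2 := mul_le_mul_of_nonneg_right (min_le_right 1 μ) (sq_nonneg ‖y.snd‖)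
    have a3 := mul_le_mul_of_nonneg_right (le_max_left 1 μ) (sq_nonneg ‖b.fst‖)
    have a4 := mul_le_mul_of_nonneg_right (le_max_right 1 μ) (sq_nonneg ‖b.snd‖)
    linarith
  refine (sq_le_sq₀ (norm_nonneg _) (by positivity)).1 ?_
  rw [mul_pow, Real.sq_sqrt (by positivity), div_mul_eq_mul_div, le_div_iff₀ hm]
  linarith

instance (δ : ℝ) : CompleteSpace (E.Hs δ) :=
  Submodule.topologicalClosure.completeSpace _

lemma generates_secondOrder {ε μ : ℝ} (hε : 0 < ε) (hμ : 0 < μ) :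
    Generates (E.secondOrderOp ε μ) (E.secondOrderSemigroup ε μ) := by
  refine generates_semigroupOf ?_
  rw [E.secondOrderOp_eq ε hμ]
  exact exists_generates_diagOp E.phaseEquiv (E.norm_exp_secondOrderBlock_le hε hμ)

/-! ### The projections -/

lemma inner_e (j : ℕ) (u : HSpace D) :
    inner ℝ (E.e j) u = E.coef u (j / 2) ⟨j % 2, Nat.mod_lt j two_pos⟩ := by
  rw [PiLp.inner_apply, Finset.sum_eq_single ⟨j % 2, Nat.mod_lt j two_pos⟩]
  · simp [e, coef]
  · intro i _ hi
    simp [e, hi]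
  · simp

lemma inner_e_e {j l : ℕ} (h : j ≠ l) : inner ℝ (E.e j) (E.e l) = 0 := by
  rw [inner_e]
  unfold e
  rw [coef_single, orthonormal_iff_ite.1 E.basis.orthonormal]
  by_cases h1 : j / 2 = l / 2
  · have h2 : j % 2 ≠ l % 2 := by omega
    simp [h2]
  · simp [h1]

/-- Block `k` consists of the basis vectors with indices `2k` and `2k + 1`, so the first `2n`
vectors are precisely the blocks `k < n`. -/
lemma coef_P (n : ℕ) (u : HSpace D) (k : ℕ) :
    E.coef (E.P n u) k = if k < n then E.coef u k else 0 := by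
  have : FiniteDimensional ℝ (Submodule.span ℝ (Set.range fun k : Fin (2 * n) => E.e k)) :=
    FiniteDimensional.span_of_finite ℝ (Set.finite_range _)
  have : CompleteSpace (Submodule.span ℝ (Set.range fun k : Fin (2 * n) => E.e k)) :=
    FiniteDimensional.complete ℝ _
  have hP : E.P n u =
    (Submodule.span ℝ (Set.range fun k : Fin (2 * n) => E.e k)).starProjection u := rfl
  have hlt : ∀ j, j < 2 * n → inner ℝ (E.e j) (E.P n u) = inner ℝ (E.e j) u := fun j hj => by
    have h := Submodule.starProjection_inner_eq_zero
      (K := Submodule.span ℝ (Set.range fun k : Fin (2 * n) => E.e k)) u (E.e j)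
      (Submodule.subset_span ⟨⟨j, hj⟩, rfl⟩)
    rw [← hP, inner_sub_left, sub_eq_zero] at h
    rw [real_inner_comm, ← h, real_inner_comm]
  have hge : ∀ j, 2 * n ≤ j → inner ℝ (E.e j) (E.P n u) = 0 := fun j hj => by
    have hle : Submodule.span ℝ (Set.range fun k : Fin (2 * n) => E.e k) ≤
        LinearMap.ker (innerₛₗ ℝ (E.e j)) := by
      refine Submodule.span_le.2 ?_
      rintro _ ⟨l, rfl⟩
      exact E.inner_e_e (by have := l.2; omega)
    exact hle (hP ▸ Submodule.starProjection_apply_mem _ u)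
  have hk : ∀ (v : HSpace D) (i : Fin 2), E.coef v k i = inner ℝ (E.e (2 * k + i)) v := by
    intro v i
    rw [inner_e]
    fin_cases i
    · have h1 : 2 * k / 2 = k := by omega
      have h2 : 2 * k % 2 = 0 := by omega
      simp [h1, h2]
    · have h1 : (2 * k + 1) / 2 = k := by omega
      have h2 : (2 * k + 1) % 2 = 1 := by omega
      simp [h1, h2]
  ext i
  have hi := i.2
  rw [hk]
  split_ifs with h
  · rw [hlt _ (by omega), hk]
  · rw [hge _ (by omega)]
    rfl

/-! ### Convergence -/

lemma coef_firstOrderSemigroup {ε : ℝ} (hε : 0 < ε) {x : HSpace D} {n : ℕ}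
    (hx : ∀ k, n ≤ k → E.coef x k = 0) (t : ℝ≥0) (k : ℕ) :
    E.coef (firstOrderSemigroup D ε t x) k =
      NormedSpace.exp ((t : ℝ) • (-(E.eig k) • matActCLM (Jmat ε)⁻¹)) (E.coef x k) := by
  have hg := E.generates_firstOrder hε
  rw [E.firstOrderOp_eq] at hg
  obtain ⟨y, hy⟩ := exists_mem_diagOp E.coefEquiv
    (fun k => -(E.eig k) • matActCLM (Jmat ε)⁻¹) hx
  exact hg.coord_apply E.coefEquiv hy t k

lemma coef_secondOrderSemigroup {ε μ : ℝ} (hε : 0 < ε) (hμ : 0 < μ) {p : E.Phase} {n : ℕ}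
    (hp : ∀ k, n ≤ k → E.phaseEquiv p k = 0) (t : ℝ≥0) (k : ℕ) :
    E.coef (E.secondOrderSemigroup ε μ t p).fst k = E.pos ε μ k (E.phaseEquiv p k) t := by
  have hg := E.generates_secondOrder hε hμ
  rw [E.secondOrderOp_eq ε hμ] at hg
  obtain ⟨y, hy⟩ := exists_mem_diagOp E.phaseEquiv (E.secondOrderBlock ε μ) hp
  exact congrArg WithLp.fst (hg.coord_apply E.phaseEquiv hy t k)

lemma pos_smul (ε μ : ℝ) (k : ℕ) (c : ℝ) (b : Block) (t : ℝ) :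
    E.pos ε μ k (c • b) t = c • E.pos ε μ k b t :=
  congrArg WithLp.fst (map_smul (NormedSpace.exp (t • E.secondOrderBlock ε μ k)) c b)

lemma coef_sub (u v : HSpace D) (k : ℕ) : E.coef (u - v) k = E.coef u k - E.coef v k := by
  ext1 i
  simp [coef, inner_sub_right]

lemma coef_P_of_le {n k : ℕ} (h : n ≤ k) (u : HSpace D) : E.coef (E.P n u) k = 0 := by
  rw [coef_P, if_neg (not_lt.2 h)]

lemma norm_coef_P_le (n : ℕ) {u : HSpace D} (hu : ‖u‖ ≤ 1) (k : ℕ) : ‖E.coef (E.P n u) k‖ ≤ 1 := by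
  rw [coef_P]
  split_ifs
  · exact (E.norm_coef_le u k).trans hu
  · simp

lemma norm_position_sub_le {ε μ : ℝ} (hε : 0 < ε) (hμ : 0 < μ) (n : ℕ) {t T : ℝ≥0} (ht : t ≤ T)
    {x : HSpace D} (hx : ‖x‖ ≤ 1) :
    ‖(E.secondOrderSemigroup ε μ t (WithLp.toLp 2 (E.P n x, 0))).fst
      - firstOrderSemigroup D ε t (E.P n x)‖ ≤
      ∑ k ∈ Finset.range n, √(μ * E.eig k) * Real.exp (E.eig k * T) := by
  have hp : ∀ k, E.phaseEquiv (WithLp.toLp 2 (E.P n x, 0)) k =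
      WithLp.toLp 2 (E.coef (E.P n x) k, 0) := fun k => rfl
  have h0 : ∀ k, n ≤ k → E.phaseEquiv (WithLp.toLp 2 (E.P n x, 0)) k = 0 := fun k hk => by
    rw [hp, E.coef_P_of_le hk]
    rfl
  have hc : ∀ k, E.coefEquiv ((E.secondOrderSemigroup ε μ t (WithLp.toLp 2 (E.P n x, 0))).fst
      - firstOrderSemigroup D ε t (E.P n x)) k =
      E.pos ε μ k (E.phaseEquiv (WithLp.toLp 2 (E.P n x, 0)) k) t -
      NormedSpace.exp ((t : ℝ) • (-(E.eig k) • matActCLM (Jmat ε)⁻¹)) (E.coef (E.P n x) k) :=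
    fun k => by
      rw [coefEquiv_apply, coef_sub, E.coef_secondOrderSemigroup hε hμ h0,
        E.coef_firstOrderSemigroup hε (fun k hk => E.coef_P_of_le hk x)]
  refine norm_le_sum_of_coord E.coefEquiv (fun k hk => ?_) (fun k _ => ?_)
  · rw [hc, h0 k hk, E.coef_P_of_le hk, map_zero, sub_zero]
    exact congrArg WithLp.fst (map_zero (NormedSpace.exp ((t : ℝ) • E.secondOrderBlock ε μ k)))
  · rw [hc, hp]
    have hz0 := exp_zero_smul_apply (-(E.eig k) • matActCLM (Jmat ε)⁻¹) (E.coef (E.P n x) k)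
    refine (isFriction_Jmat ε).norm_sub_le_of_velocity_zero hε (E.eig_pos k) hμ
      (E.hasDerivAt_pos ε hμ k _) (E.hasDerivAt_momentum ε hμ k _)
      (E.hasDerivAt_firstOrderBlock ε k _) ?_ ?_ ?_ ⟨t.2, NNReal.coe_le_coe.2 ht⟩
    · exact (E.pos_zero ε μ k _).trans hz0.symm
    · exact (E.momentum_zero ε μ k _).trans (smul_zero _)
    · exact (congrArg norm hz0).trans_le (E.norm_coef_P_le n hx k)

lemma norm_velocity_sub_le {ε μ : ℝ} (hε : 0 < ε) (hμ : 0 < μ) (n : ℕ) {t₀ t T : ℝ≥0}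
    (ht₀ : t₀ ≤ t) (ht : t ≤ T) {y : HSpace D} (hy : ‖y‖ ≤ 1) :
    ‖μ⁻¹ • (E.secondOrderSemigroup ε μ t (WithLp.toLp 2 (0, E.emb (E.P n y)))).fst
      - firstOrderSemigroup D ε t (matAct (Jmat ε)⁻¹ (E.P n y))‖ ≤
      ∑ k ∈ Finset.range n,
        (E.eig k * μ * ((3 + Real.exp (E.eig k * T)) * Real.exp (E.eig k * T)) +
        (1 + E.eig k * μ) * √(Real.exp (-(ε / μ * t₀)) +
          (μ * E.eig k * (1 + Real.exp (E.eig k * T)) / ε) ^ 2)) := by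
  have hp : ∀ k, E.phaseEquiv (WithLp.toLp 2 (0, E.emb (E.P n y))) k =
      WithLp.toLp 2 (0, (√(E.eig k))⁻¹ • E.coef (E.P n y) k) := fun k => by
    have h1 : E.coef 0 k = 0 := by
      ext i
      simp [coef]
    rw [phaseEquiv_apply]
    change WithLp.toLp 2 (E.coef 0 k, (E.emb (E.P n y) : Seq2) k) = _
    rw [h1, emb_apply]
  have h0 : ∀ k, n ≤ k → E.phaseEquiv (WithLp.toLp 2 (0, E.emb (E.P n y))) k = 0 := fun k hk => by
    rw [hp, E.coef_P_of_le hk, smul_zero]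
    rfl
  have hJ : ∀ k, n ≤ k → E.coef (matAct (Jmat ε)⁻¹ (E.P n y)) k = 0 := fun k hk => by
    rw [coef_matAct, E.coef_P_of_le hk, ← matActCLM_apply, map_zero]
  have hc : ∀ k, E.coefEquiv
      (μ⁻¹ • (E.secondOrderSemigroup ε μ t (WithLp.toLp 2 (0, E.emb (E.P n y)))).fst
        - firstOrderSemigroup D ε t (matAct (Jmat ε)⁻¹ (E.P n y))) k =
      E.pos ε μ k (μ⁻¹ • E.phaseEquiv (WithLp.toLp 2 (0, E.emb (E.P n y))) k) t -
      NormedSpace.exp ((t : ℝ) • (-(E.eig k) • matActCLM (Jmat ε)⁻¹))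
        (E.coef (matAct (Jmat ε)⁻¹ (E.P n y)) k) :=
    fun k => by
      rw [coefEquiv_apply, coef_sub, coef_smul, E.coef_secondOrderSemigroup hε hμ h0,
        E.coef_firstOrderSemigroup hε hJ, pos_smul]
  refine norm_le_sum_of_coord E.coefEquiv (fun k hk => ?_) (fun k _ => ?_)
  · rw [hc, h0 k hk, hJ k hk, map_zero, sub_zero, smul_zero]
    exact congrArg WithLp.fst (map_zero (NormedSpace.exp ((t : ℝ) • E.secondOrderBlock ε μ k)))
  · rw [hc, hp]
    have hz0 := exp_zero_smul_apply (-(E.eig k) • matActCLM (Jmat ε)⁻¹)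
      (E.coef (matAct (Jmat ε)⁻¹ (E.P n y)) k)
    -- The prefactor `1/μ`, moved onto the initial datum by linearity, cancels the mass in the
    -- momentum, and the `H^{-1}` weight cancels `√α_k`.
    have hw0 : E.momentum ε μ k (μ⁻¹ • WithLp.toLp 2 (0, (√(E.eig k))⁻¹ • E.coef (E.P n y) k)) 0 =
        E.coef (E.P n y) k := by
      rw [momentum_zero]
      change (μ * √(E.eig k)) • μ⁻¹ • (√(E.eig k))⁻¹ • E.coef (E.P n y) k = _
      have hs := (E.sqrt_eig_pos k).ne'
      have h1 : μ * √(E.eig k) * (μ⁻¹ * (√(E.eig k))⁻¹) = 1 := by field_simp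
      rw [smul_smul μ⁻¹, smul_smul, h1, one_smul]
    refine (isFriction_Jmat ε).norm_sub_le_of_position_zero hε (E.eig_pos k) hμ
      (E.hasDerivAt_pos ε hμ k _) (E.hasDerivAt_momentum ε hμ k _)
      (E.hasDerivAt_firstOrderBlock ε k _) ?_ ?_ ?_ t₀.2
      ⟨NNReal.coe_le_coe.2 ht₀, NNReal.coe_le_coe.2 ht⟩
    · exact (E.pos_zero ε μ k _).trans (smul_zero _)
    · rw [hw0]
      exact hz0.trans (E.coef_matAct _ _ k)
    · rw [hw0]
      exact E.norm_coef_P_le n hy k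

lemma tendsto_position_bound (T : ℝ≥0) (n : ℕ) :
    Tendsto (fun μ : ℝ => ∑ k ∈ Finset.range n, √(μ * E.eig k) * Real.exp (E.eig k * T))
      (𝓝[>] 0) (𝓝 0) := by
  refine Tendsto.mono_left ?_ nhdsWithin_le_nhds
  exact Continuous.tendsto' (by fun_prop) _ _ (by simp)

lemma tendsto_velocity_bound {ε : ℝ} (hε : 0 < ε) {t₀ : ℝ≥0} (ht₀ : 0 < t₀) (T : ℝ≥0) (n : ℕ) :
    Tendsto (fun μ : ℝ => ∑ k ∈ Finset.range n,
        (E.eig k * μ * ((3 + Real.exp (E.eig k * T)) * Real.exp (E.eig k * T)) +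
        (1 + E.eig k * μ) * √(Real.exp (-(ε / μ * t₀)) +
          (μ * E.eig k * (1 + Real.exp (E.eig k * T)) / ε) ^ 2)))
      (𝓝[>] 0) (𝓝 0) := by
  -- The initial layer disappears only because `t₀ > 0`.
  have h1 : Tendsto (fun μ : ℝ => Real.exp (-(ε / μ * t₀))) (𝓝[>] 0) (𝓝 0) := by
    refine Real.tendsto_exp_neg_atTop_nhds_zero.comp ?_
    refine Tendsto.atTop_mul_const (NNReal.coe_pos.2 ht₀) ?_
    exact (tendsto_inv_nhdsGT_zero.const_mul_atTop hε).congr fun μ => (div_eq_mul_inv ε μ).symm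
  have hid : Tendsto (fun μ : ℝ => μ) (𝓝[>] 0) (𝓝 0) := tendsto_id.mono_left nhdsWithin_le_nhds
  have key : ∀ a b c : ℝ, Tendsto (fun μ : ℝ => a * μ * b + (1 + a * μ) *
      √(Real.exp (-(ε / μ * t₀)) + (μ * a * c / ε) ^ 2)) (𝓝[>] 0) (𝓝 0) := fun a b c => by
    have h2 := ((hid.const_mul a).mul_const b).add (((hid.const_mul a).const_add 1).mul
      ((h1.add ((((hid.mul_const a).mul_const c).div_const ε).pow 2)).sqrt))
    simpa using h2
  simpa using tendsto_finsetSum (Finset.range n) fun k _ =>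
    key (E.eig k) ((3 + Real.exp (E.eig k * T)) * Real.exp (E.eig k * T))
      (1 + Real.exp (E.eig k * T))

end DirichletEigenbasis

end SmallMass

lemma tendsto_zero_of_le_ofReal {f : ℝ → ℝ≥0∞} {B : ℝ → ℝ} (hB : Tendsto B (𝓝[>] 0) (𝓝 0))
    (h : ∀ μ, 0 < μ → f μ ≤ ENNReal.ofReal (B μ)) : Tendsto f (𝓝[>] 0) (𝓝 0) := by
  have h1 : Tendsto (fun μ => ENNReal.ofReal (B μ)) (𝓝[>] 0) (𝓝 0) := by
    simpa using ENNReal.tendsto_ofReal hB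
  refine tendsto_of_tendsto_of_tendsto_of_le_of_le' tendsto_const_nhds h1
    (Eventually.of_forall fun _ => zero_le) ?_
  filter_upwards [self_mem_nhdsWithin] with μ hμ using h μ hμ

end
end MagneticSK

theorem mainTheorem6 {d : ℕ} (D : TopologicalSpace.Opens (EuclideanSpace ℝ (Fin d)))
    (hD : Bornology.IsBounded (D : Set (EuclideanSpace ℝ (Fin d))))
    (E : MagneticSK.DirichletEigenbasis D) (ε : ℝ) (hε : 0 < ε)
    (t₀ T : ℝ≥0) (ht₀ : 0 < t₀) (ht₀T : t₀ < T) (n : ℕ) :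
    (∀ μ : ℝ, 0 < μ →
      MagneticSK.Generates (E.secondOrderOp ε μ) (E.secondOrderSemigroup ε μ)) ∧
    MagneticSK.Generates (MagneticSK.firstOrderOp D ε) (MagneticSK.firstOrderSemigroup D ε) ∧
    Tendsto (fun μ : ℝ => ⨆ (t : ℝ≥0) (_ : t ≤ T) (x : MagneticSK.HSpace D) (_ : ‖x‖ ≤ 1),
        ‖(E.secondOrderSemigroup ε μ t (WithLp.toLp 2 (E.P n x, 0))).fst
          - MagneticSK.firstOrderSemigroup D ε t (E.P n x)‖ₑ)
      (𝓝[>] 0) (𝓝 0) ∧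
    Tendsto (fun μ : ℝ => ⨆ (t : ℝ≥0) (_ : t₀ ≤ t ∧ t ≤ T) (y : MagneticSK.HSpace D)
        (_ : ‖y‖ ≤ 1),
        ‖μ⁻¹ • (E.secondOrderSemigroup ε μ t (WithLp.toLp 2 (0, E.emb (E.P n y)))).fst
          - MagneticSK.firstOrderSemigroup D ε t
              (MagneticSK.matAct (MagneticSK.Jmat ε)⁻¹ (E.P n y))‖ₑ)
      (𝓝[>] 0) (𝓝 0) := by
  refine ⟨fun μ hμ => E.generates_secondOrder hε hμ, E.generates_firstOrder hε,
    MagneticSK.tendsto_zero_of_le_ofReal (E.tendsto_position_bound T n) fun μ hμ => ?_,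
    MagneticSK.tendsto_zero_of_le_ofReal (E.tendsto_velocity_bound hε ht₀ T n) fun μ hμ => ?_⟩
  · refine iSup₂_le fun t ht => iSup₂_le fun x hx => ?_
    rw [← ofReal_norm]
    exact ENNReal.ofReal_le_ofReal (E.norm_position_sub_le hε hμ n ht hx)
  · refine iSup₂_le fun t ht => iSup₂_le fun y hy => ?_
    rw [← ofReal_norm]
    exact ENNReal.ofReal_le_ofReal (E.norm_velocity_sub_le hε hμ n ht.1 ht.2 hy)
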